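/- **Theorem (Dirichlet–Cheeger inequality).** Let $M$ be a connected, Hausdorff, second countable smooth manifold of dimension $n$ without boundary (for instance $M=\mathbb R^n$ or $M$ compact), let $X_1,\dots,X_m$ be smooth vector fields on $M$ that are bracket-generating (at every point $p$, the values at $p$ of the fields in the Lie algebra generated by the fields $\sum_j a_jX_j$, $a_j\in C^\infty(M)$, fill $T_pM$; the rank of $\operatorname{span}\{X_1(p),\dots,X_m(p)\}$ may vary with $p$), and let $\omega$ be a smooth volume form on $M$. Write $\omega$ also for the measure it induces, define $\operatorname{div}_\omega$ by $L_V\omega=\operatorname{div}_\omega(V)\,\omega$, and put $X_j^*\varphi=-X_j\varphi-\operatorname{div}_\omega(X_j)\varphi$. Let $\Omega\subseteq M$ be a nonempty, bounded (that is, relatively compact) open set; this includes bounded domains with piecewise smooth boundary, but neither connectedness nor regularity of $\partial\Omega$ is needed. *Cheeger constant.* For measurable $E\subseteq M$ the horizontal perimeter of $E$ in $\Omega$ is $$P_H(E;\Omega)=\sup\Big\{\int_\Omega \chi_E\sum_{j=1}^m X_j^*\varphi_j\,\omega \;:\; \varphi\in C_0^\infty(\Omega;\mathbb R^m),\ \sup_{\Omega}|\varphi|\le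 1\Big\}\in[0,\infty],$$ and $$h_D(\Omega)=\inf_A \frac{P_H(A;\Omega)}{\omega(A)},$$ where $A$ runs over the nonempty open sets with piecewise smooth boundary whose closure is compact and contained in $\Omega$. Here $A$ has piecewise smooth boundary if every $p\in\partial A$ has an open neighbourhood $U$ with smooth functions $\rho_1,\dots,\rho_k:U\to\mathbb R$, $d\rho_i\neq0$ on $U$, such that $A\cap U$ is a finite union of finite intersections of the sets $\{\rho_i<0\}$. *First eigenvalue.* Let $S^1(\Omega)$ be the space of $u\in L^2(\Omega)$ whose distributional derivatives $X_1u,\dots,X_mu$ lie in $L^2(\Omega)$, with $\|u\|_{S^1}^2=\|u\|^2+\sum_j\|X_ju\|^2$, and let $S^1_0(\Omega)$ be the closure of $C_0^\infty(\Omega)$ in $S^1(\Omega)$. The Dirichlet sub-Laplacian $-\Delta_D$ is the self-adjoint operator on $L^2(\Omega)$ given by: $u\in D(-\Delta_D)$ and $-\Delta_Du=w$ if and only if $u\in S_0^1(\Omega)$ and $\sum_j\langle X_jv,X_ju\rangle=\langle v,w\rangle$ for all $v\in S^1_0(\Omega)$. Let $\lambda_1^D(\Omega)$ be the bottom of its spectrum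 (the first Dirichlet eigenvalue, when the spectrum is discrete). Then $$\lambda_1^D(\Omega)\ \ge\ \tfrac14\,h_D(\Omega)^2 .$$ -/

import Mathlib

open Set Filter Topology MeasureTheory
open scoped Manifold ContDiff ENNReal

noncomputable section

namespace CC

/-- Smooth manifolds of dimension `n` are modelled on this space. -/
abbrev Model (n : ℕ) := EuclideanSpace ℝ (Fin n)

/-! ### Vector fields, volume forms, CC-spaces -/

section Manifold

variable {n m : ℕ} {M : Type*} [TopologicalSpace M] [ChartedSpace (Model n) M]

/-- The coefficient `ω(∂₁, …, ∂ₙ)` of a top-degree form `ω = vf` in the coordinates of the preferred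
chart at `p`, as a function on the coordinate domain. -/
def coordDensity (vf : (p : M) → TangentSpace (𝓡 n) p [⋀^Fin n]→ₗ[ℝ] ℝ) (p : M)
    (y : Model n) : ℝ :=
  vf ((extChartAt (𝓡 n) p).symm y) fun i =>
    mfderiv 𝓘(ℝ, Model n) (𝓡 n) (extChartAt (𝓡 n) p).symm y
      ((EuclideanSpace.single i (1 : ℝ) : Model n) : TangentSpace 𝓘(ℝ, Model n) y)

/-- The Lie algebra generated by the horizontal vector fields: the smallest real Lie algebra of
vector fields containing all combinations `∑ aⱼ Xⱼ` with smooth coefficients. -/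
inductive LieHull (X : Fin m → (p : M) → TangentSpace (𝓡 n) p) :
    ((p : M) → TangentSpace (𝓡 n) p) → Prop
  | horizontal (a : Fin m → M → ℝ) (ha : ∀ j, ContMDiff (𝓡 n) 𝓘(ℝ, ℝ) ∞ (a j)) :
      LieHull X (fun p => ∑ j, a j p • X j p)
  | add (V W : (p : M) → TangentSpace (𝓡 n) p) (hV : LieHull X V) (hW : LieHull X W) :
      LieHull X (fun p => V p + W p)
  | smul (c : ℝ) (V : (p : M) → TangentSpace (𝓡 n) p) (hV : LieHull X V) :
      LieHull X (fun p => c • V p)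
  | bracket (V W : (p : M) → TangentSpace (𝓡 n) p) (hV : LieHull X V) (hW : LieHull X W) :
      LieHull X (VectorField.mlieBracket (𝓡 n) V W)

end Manifold

/-- A Carnot–Carathéodory structure on the `n`-dimensional manifold `M`: a generating family of
smooth vector fields `X₁, …, Xₘ` which is bracket-generating (no condition on the rank), and a
smooth volume form `ω`, that is, a nowhere vanishing smooth `n`-form. -/
structure CCSpace (n m : ℕ) (M : Type*) [TopologicalSpace M] [ChartedSpace (Model n) M]
    [IsManifold (𝓡 n) ∞ M] where
  /-- the generating family -/
  X : Fin m → (p : M) → TangentSpace (𝓡 n) p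
  smooth_X : ∀ j, ContMDiff (𝓡 n) (𝓡 n).tangent ∞ (fun p => (⟨p, X j p⟩ : TangentBundle (𝓡 n) M))
  bracket_generating : ∀ (p : M) (v : TangentSpace (𝓡 n) p), ∃ V, LieHull X V ∧ V p = v
  /-- the volume form `ω` -/
  form : (p : M) → TangentSpace (𝓡 n) p [⋀^Fin n]→ₗ[ℝ] ℝ
  smooth_form : ∀ p, ContDiffOn ℝ ∞ (coordDensity form p) (extChartAt (𝓡 n) p).target
  form_ne_zero : ∀ p, form p ≠ 0

section PiecewiseSmooth

variable (n : ℕ) {M : Type*} [TopologicalSpace M] [ChartedSpace (Model n) M]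

/-- The set `A` has piecewise smooth boundary: near each of its boundary points, `A` is a finite
union of finite intersections of smooth half-spaces `{ρᵢ < 0}` with `dρᵢ ≠ 0`, so that the boundary
is locally contained in finitely many smooth hypersurfaces `{ρᵢ = 0}`. -/
def HasPiecewiseSmoothBoundary (A : Set M) : Prop :=
  ∀ p ∈ frontier A, ∃ U : Set M, IsOpen U ∧ p ∈ U ∧
    ∃ (k : ℕ) (ρ : Fin k → M → ℝ) (S : Set (Set (Fin k))),
      (∀ i, ContMDiffOn (𝓡 n) 𝓘(ℝ, ℝ) ∞ (ρ i) U) ∧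
      (∀ i, ∀ q ∈ U, mfderiv (𝓡 n) 𝓘(ℝ, ℝ) (ρ i) q ≠ 0) ∧
      ∀ q ∈ U, q ∈ A ↔ ∃ s ∈ S, ∀ i ∈ s, ρ i q < 0

/-- The space `C₀^∞(Ω)` of smooth functions with compact support in `Ω`. -/
def IsTestFunction (Ω : Set M) (φ : M → ℝ) : Prop :=
  ContMDiff (𝓡 n) 𝓘(ℝ, ℝ) ∞ φ ∧ HasCompactSupport φ ∧ tsupport φ ⊆ Ω

end PiecewiseSmooth

namespace CCSpace

variable {n m : ℕ} {M : Type*} [TopologicalSpace M] [ChartedSpace (Model n) M]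
  [IsManifold (𝓡 n) ∞ M]
variable (C : CCSpace n m M)

/-! ### Differential operators -/

/-- The derivative `Xⱼ u`. -/
def deriv (j : Fin m) (u : M → ℝ) (p : M) : ℝ :=
  mfderiv (𝓡 n) 𝓘(ℝ, ℝ) u p (C.X j p)

/-- The divergence `div_ω V`, defined by `L_V ω = div_ω(V) ω`. In coordinates in which
`ω = ρ dy¹ ∧ ⋯ ∧ dyⁿ` and `V = ∑ Vⁱ ∂ᵢ`, this is `ρ⁻¹ ∑ ∂ᵢ (ρ Vⁱ)`; the coordinates used at the
point `p` are those of the preferred chart at `p`. -/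
def divergence (V : (p : M) → TangentSpace (𝓡 n) p) (p : M) : ℝ :=
  let e := extChartAt (𝓡 n) p
  let ρ : Model n → ℝ := coordDensity C.form p
  let W : Model n → Model n := fun y =>
    VectorField.mpullback 𝓘(ℝ, Model n) (𝓡 n) e.symm V y
  (ρ (e p))⁻¹ *
    LinearMap.trace ℝ (Model n) (fderiv ℝ (fun y => ρ y • W y) (e p) : Model n →ₗ[ℝ] Model n)

/-- The formal adjoint `Xⱼ* φ = - Xⱼ φ - div_ω(Xⱼ) φ`. -/
def formalAdjoint (j : Fin m) (φ : M → ℝ) (p : M) : ℝ :=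
  - C.deriv j φ p - C.divergence (C.X j) p * φ p

/-! ### The measure of the volume form `ω` -/

variable [MeasurableSpace M]

/-- The measure `|ω(∂₁, …, ∂ₙ)| dy` on the domain of the preferred chart at `p`, as a measure on
`M` that vanishes outside this domain. -/
def chartMeasure (p : M) : Measure M :=
  Measure.map (extChartAt (𝓡 n) p).symm
    ((volume.restrict (extChartAt (𝓡 n) p).target).withDensity
      fun y => ENNReal.ofReal |coordDensity C.form p y|)

/-- The measure on `M` induced by the volume form. The measures of the charts agree on overlaps,
hence they are the restrictions of one measure to the chart domains, which is their supremum. -/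
def vol : Measure M := ⨆ p : M, C.chartMeasure p

/-! ### Horizontal perimeter and the Dirichlet–Cheeger constant -/

/-- The class `ℱ(Ω)` of `φ ∈ C₀^∞(Ω; ℝᵐ)` with `‖φ‖_∞ ≤ 1`. -/
def testFields (Ω : Set M) : Set (Fin m → M → ℝ) :=
  {φ | (∀ j, IsTestFunction n Ω (φ j)) ∧ ∀ p, √(∑ j, φ j p ^ 2) ≤ 1}

/-- The horizontal variation `Var_H(u; Ω)`. -/
def horizontalVariation (u : M → ℝ) (Ω : Set M) : ℝ≥0∞ :=
  ⨆ φ ∈ testFields (n := n) (m := m) Ω,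
    ENNReal.ofReal (∫ x in Ω, u x * ∑ j, C.formalAdjoint j (φ j) x ∂C.vol)

/-- The horizontal perimeter `P_H(E; Ω)`. -/
def horizontalPerimeter (E Ω : Set M) : ℝ≥0∞ :=
  C.horizontalVariation (E.indicator 1) Ω

/-- The Dirichlet–Cheeger constant `h_D(Ω)`: the infimum of `P_H(A; Ω) / ω(A)` over the nonempty
open sets `A` with piecewise smooth boundary that are compactly contained in `Ω`. -/
def cheegerD (Ω : Set M) : ℝ≥0∞ :=
  ⨅ (A : Set M) (_ : IsOpen A ∧ A.Nonempty ∧ IsCompact (closure A) ∧ closure A ⊆ Ω ∧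
      HasPiecewiseSmoothBoundary n A),
    C.horizontalPerimeter A Ω / C.vol A

/-! ### Sobolev spaces, the Dirichlet sub-Laplacian and its first eigenvalue -/

/-- The space `L²(Ω)`. -/
abbrev L2 (Ω : Set M) := Lp ℝ 2 (C.vol.restrict Ω)

/-- The Sobolev space `S¹(Ω)`, as the set of pairs `(u, (X₁ u, …, Xₘ u))` of a function
`u ∈ L²(Ω)` and its distributional derivatives, which are required to lie in `L²(Ω)`. -/
def sobolev (Ω : Set M) : Set (C.L2 Ω × (Fin m → C.L2 Ω)) :=
  {U | ∀ j, ∀ φ : M → ℝ, IsTestFunction n Ω φ →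
    ∫ x in Ω, U.1 x * C.formalAdjoint j φ x ∂C.vol = ∫ x in Ω, U.2 j x * φ x ∂C.vol}

/-- The space `S₀¹(Ω)`: the closure of `C₀^∞(Ω)` in `S¹(Ω)`. -/
def sobolevZero (Ω : Set M) : Set (C.L2 Ω × (Fin m → C.L2 Ω)) :=
  {U | U ∈ C.sobolev Ω ∧ ∀ ε : ℝ≥0∞, 0 < ε → ∃ φ : M → ℝ, IsTestFunction n Ω φ ∧
    eLpNorm (fun x => U.1 x - φ x) 2 (C.vol.restrict Ω) < ε ∧
    ∀ j, eLpNorm (fun x => U.2 j x - C.deriv j φ x) 2 (C.vol.restrict Ω) < ε}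

/-- The quadratic form `∫_Ω g(∇_H u, ∇_H v) ω = ∑ⱼ ⟨Xⱼ u, Xⱼ v⟩`. -/
def dirichletForm {Ω : Set M} (U V : C.L2 Ω × (Fin m → C.L2 Ω)) : ℝ :=
  ∑ j, inner ℝ (U.2 j) (V.2 j)

/-- The graph of the Dirichlet sub-Laplacian, the Friedrichs extension associated with the form:
`u ∈ D(-Δ_D)` and `-Δ_D u = w`. -/
def IsNegDirichletLaplacian {Ω : Set M} (u w : C.L2 Ω) : Prop :=
  ∃ U ∈ C.sobolevZero Ω, U.1 = u ∧ ∀ V ∈ C.sobolevZero Ω, C.dirichletForm V U = inner ℝ V.1 w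

/-- The spectrum of `-Δ_D`: the real numbers `l` for which `-Δ_D - l : D(-Δ_D) → L²(Ω)` does not
have a bounded inverse. -/
def dirichletSpectrum (Ω : Set M) : Set ℝ :=
  {l | ¬ ∃ R : C.L2 Ω →L[ℝ] C.L2 Ω,
    (∀ f, C.IsNegDirichletLaplacian (R f) (f + l • R f)) ∧
    ∀ u w, C.IsNegDirichletLaplacian u w → R (w - l • u) = u}

/-- The first Dirichlet eigenvalue `λ₁^D(Ω)`: the bottom of the spectrum of `-Δ_D`. -/
def firstEigenvalueD (Ω : Set M) : EReal :=
  ⨅ l ∈ C.dirichletSpectrum Ω, (l : EReal)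

end CCSpace

end CC

end

/-! This is Cheeger's argument, run on test functions and then transferred to the operator. Write
`h` for the Cheeger constant and let `φ` be a test function in `Ω`. By Sard's theorem almost every
`t > 0` is a regular value of `φ²`. The set `{φ² > t}` is then empty or a competitor for `h`, so its
horizontal perimeter is at least `h` times its volume. Integration in `t`, with the layer-cake
formula on one side and the coarea inequality on the other, gives `h ∫ φ² ≤ ∫ |∇_H φ²| = 2 ∫ |φ|
|∇_H φ|` (`cheegerD_mul_lintegral_le`). By Cauchy–Schwarz, `h² / 4 · ∫ φ² ≤ ∫ |∇_H φ|²`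
(`poincare`), and the inequality passes to the closure `S₀¹(Ω)`.

For `l` below `h² / 4` the form `∑ ⟨Xⱼ u, Xⱼ v⟩ - l ⟨u, v⟩` is therefore coercive on `S₀¹(Ω)`, and
Lax–Milgram produces a bounded inverse of `-Δ_D - l` (`exists_resolvent_of_lt`). So `l` is not in
the spectrum; neither discreteness nor the spectral theorem enters.

Only one half of the coarea formula is needed (`mul_lintegral_superlevel_le`). It follows from
replacing the indicator of a superlevel set by smooth steps and integrating by parts
(`integral_mul_formalAdjoint`). Since the measure and the divergence are defined chart by chart,
integration by parts rests on their independence of the chart: the change of variables formula for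
the measure, the Piola identity (`trace_fderiv_piola`) for the divergence. -/

/-! ### Hilbert space theory: the resolvent below the bottom of a closed form. -/

/-- Lax–Milgram for the form `⟪G u, G v⟫ - l ⟪P u, P v⟫` with `l` below the bottom of the Rayleigh
quotient. -/
theorem exists_weakSolution_of_lt {V L W : Type*}
    [NormedAddCommGroup V] [InnerProductSpace ℝ V] [CompleteSpace V]
    [NormedAddCommGroup L] [InnerProductSpace ℝ L] [CompleteSpace L]
    [NormedAddCommGroup W] [InnerProductSpace ℝ W]
    (P : V →L[ℝ] L) (G : V →L[ℝ] W) (hnorm : ∀ v, ‖v‖ ^ 2 = ‖P v‖ ^ 2 + ‖G v‖ ^ 2)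
    {c l : ℝ} (hc : 0 ≤ c) (hl : l < c) (hP : ∀ v, c * ‖P v‖ ^ 2 ≤ ‖G v‖ ^ 2) :
    ∃ T : L →L[ℝ] V,
      (∀ f v, inner ℝ (G v) (G (T f)) - l * inner ℝ (P v) (P (T f)) = inner ℝ (P v) f) ∧
      ∀ u f, (∀ v, inner ℝ (G v) (G u) - l * inner ℝ (P v) (P u) = inner ℝ (P v) f) →
        u = T f := by
  let B : V →L[ℝ] V →L[ℝ] ℝ :=
    (innerSL ℝ).bilinearComp G G - l • (innerSL ℝ).bilinearComp P P
  have hB : ∀ u v, B u v = inner ℝ (G u) (G v) - l * inner ℝ (P u) (P v) := fun u v => by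
    simp [B]
  have hco : IsCoercive B := by
    -- The last condition says `ε (1 + c) ≤ c - l`. Keeping `ε ‖G u‖²` and bounding the rest by `(1
    -- - ε) c ‖P u‖²` leaves at least `ε (‖G u‖² + ‖P u‖²) = ε ‖u‖²`.
    obtain ⟨ε, hε, hε1, hε2⟩ : ∃ ε : ℝ, 0 < ε ∧ ε ≤ 1 ∧ ε + l ≤ (1 - ε) * c := by
      refine ⟨min 1 ((c - l) / (1 + c)), lt_min one_pos (by apply div_pos <;> linarith),
        min_le_left _ _, ?_⟩
      have h1 : min 1 ((c - l) / (1 + c)) ≤ (c - l) / (1 + c) := min_le_right _ _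
      have h2 := (le_div_iff₀ (by linarith : (0 : ℝ) < 1 + c)).1 h1
      linarith
    refine ⟨ε, hε, fun u => ?_⟩
    rw [hB, real_inner_self_eq_norm_sq, real_inner_self_eq_norm_sq, mul_assoc, ← sq, hnorm]
    have h1 := mul_le_mul_of_nonneg_left (hP u) (sub_nonneg.2 hε1)
    have h2 := mul_le_mul_of_nonneg_right hε2 (sq_nonneg ‖P u‖)
    linarith
  let Φ := hco.continuousLinearEquivOfBilin
  have hΦ : ∀ u v, inner ℝ (Φ u) v = B u v := hco.continuousLinearEquivOfBilin_apply
  -- The right-hand side `v ↦ ⟪P v, f⟫` is represented in `V` by `P.adjoint f`.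
  refine ⟨Φ.symm.toContinuousLinearMap.comp P.adjoint, fun f v => ?_, fun u f h => ?_⟩
  · have := hΦ (Φ.symm (P.adjoint f)) v
    rw [hB, Φ.apply_symm_apply, ContinuousLinearMap.adjoint_inner_left] at this
    simp only [ContinuousLinearMap.comp_apply, ContinuousLinearEquiv.coe_coe]
    rw [real_inner_comm (G _) (G _), real_inner_comm (P _) (P _), real_inner_comm f]
    exact this.symm
  · have : P.adjoint f = Φ u := by
      refine ext_inner_right ℝ fun v => ?_
      rw [hΦ, hB, ContinuousLinearMap.adjoint_inner_left, real_inner_comm (G _) (G _),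
        real_inner_comm (P _) (P _), real_inner_comm (P v) f]
      exact (h v).symm
    simp [this]

theorem exists_weakSolution_of_lt_of_isClosed {H L W : Type*}
    [NormedAddCommGroup H] [InnerProductSpace ℝ H] [CompleteSpace H]
    [NormedAddCommGroup L] [InnerProductSpace ℝ L] [CompleteSpace L]
    [NormedAddCommGroup W] [InnerProductSpace ℝ W]
    (P : H →L[ℝ] L) (G : H →L[ℝ] W) (hnorm : ∀ v, ‖v‖ ^ 2 = ‖P v‖ ^ 2 + ‖G v‖ ^ 2)
    (S : Submodule ℝ H) (hS : IsClosed (S : Set H))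
    {c l : ℝ} (hc : 0 ≤ c) (hl : l < c) (hP : ∀ v ∈ S, c * ‖P v‖ ^ 2 ≤ ‖G v‖ ^ 2) :
    ∃ T : L →L[ℝ] H,
      (∀ f, T f ∈ S ∧ ∀ v ∈ S,
        inner ℝ (G v) (G (T f)) - l * inner ℝ (P v) (P (T f)) = inner ℝ (P v) f) ∧
      ∀ u ∈ S, ∀ f, (∀ v ∈ S,
        inner ℝ (G v) (G u) - l * inner ℝ (P v) (P u) = inner ℝ (P v) f) → u = T f := by
  have : CompleteSpace S := hS.completeSpace_coe
  obtain ⟨T, hT, hTu⟩ := exists_weakSolution_of_lt (P ∘L S.subtypeL) (G ∘L S.subtypeL)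
    (fun v => hnorm v) hc hl (fun v => hP v v.2)
  refine ⟨S.subtypeL ∘L T, fun f => ⟨(T f).2, fun v hv => hT f ⟨v, hv⟩⟩, fun u hu f h => ?_⟩
  exact congrArg Subtype.val (hTu ⟨u, hu⟩ f fun v => h v v.2)

/-- The product `L × (ι → L)` carries the sup norm and is not a Hilbert space. The equivalence `e`
replaces it by a space `H` with the same topology and the `ℓ²` norm, so that closed subspaces
correspond and Lax–Milgram applies in `H`. -/
theorem exists_resolvent_of_lt_of_equiv {H L ι : Type*} [Fintype ι]
    [NormedAddCommGroup H] [InnerProductSpace ℝ H] [CompleteSpace H]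
    [NormedAddCommGroup L] [InnerProductSpace ℝ L] [CompleteSpace L]
    (e : H ≃L[ℝ] L × (ι → L)) (hnorm : ∀ v, ‖v‖ ^ 2 = ‖(e v).1‖ ^ 2 + ∑ j, ‖(e v).2 j‖ ^ 2)
    (S : Submodule ℝ (L × (ι → L))) (hS : IsClosed (S : Set (L × (ι → L))))
    {c l : ℝ} (hc : 0 ≤ c) (hl : l < c)
    (hP : ∀ U ∈ S, c * ‖U.1‖ ^ 2 ≤ ∑ j, ‖U.2 j‖ ^ 2) :
    ∃ R : L →L[ℝ] L,
      (∀ f, ∃ U ∈ S, U.1 = R f ∧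
        ∀ V ∈ S, ∑ j, inner ℝ (V.2 j) (U.2 j) = inner ℝ V.1 (f + l • R f)) ∧
      ∀ w, ∀ U ∈ S, (∀ V ∈ S, ∑ j, inner ℝ (V.2 j) (U.2 j) = inner ℝ V.1 w) →
        R (w - l • U.1) = U.1 := by
  let P : H →L[ℝ] L := ContinuousLinearMap.fst ℝ L (ι → L) ∘L e.toContinuousLinearMap
  let G : H →L[ℝ] PiLp 2 (fun _ : ι => L) :=
    (PiLp.continuousLinearEquiv 2 ℝ (fun _ : ι => L)).symm.toContinuousLinearMap ∘L
      ContinuousLinearMap.snd ℝ L (ι → L) ∘L e.toContinuousLinearMap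
  have hPe : ∀ v, P v = (e v).1 := fun v => rfl
  have hGn : ∀ v, ‖G v‖ ^ 2 = ∑ j, ‖(e v).2 j‖ ^ 2 := fun v => PiLp.norm_sq_eq_of_L2 _ _
  have hGi : ∀ u v, inner ℝ (G u) (G v) = ∑ j, inner ℝ ((e u).2 j) ((e v).2 j) :=
    fun u v => PiLp.inner_apply _ _
  clear_value P G
  obtain ⟨T, hT, hTu⟩ := exists_weakSolution_of_lt_of_isClosed P G
    (fun v => by rw [hPe, hGn, hnorm]) (S.comap (e : H →ₗ[ℝ] L × (ι → L)))
    (hS.preimage e.continuous) hc hl (fun v hv => by rw [hPe, hGn]; exact hP _ hv)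
  have hsymm : ∀ U ∈ S, e.symm U ∈ S.comap (e : H →ₗ[ℝ] L × (ι → L)) := fun U hU => by
    simpa using hU
  refine ⟨P ∘L T, fun f => ⟨e (T f), (hT f).1, (hPe _).symm, fun V hV => ?_⟩, fun w U hU h => ?_⟩
  · have := (hT f).2 (e.symm V) (hsymm V hV)
    rw [hGi, hPe (e.symm V), e.apply_symm_apply] at this
    rw [ContinuousLinearMap.comp_apply, inner_add_right, inner_smul_right]
    linarith
  · rw [ContinuousLinearMap.comp_apply, ← hTu (e.symm U) (hsymm U hU), hPe, e.apply_symm_apply]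
    intro v hv
    rw [hGi, hPe (e.symm U), hPe, e.apply_symm_apply, inner_sub_right, inner_smul_right]
    exact congrArg (· - _) (h _ hv)

/-- The resolvent of the operator of a closed form `∑ ⟪Uⱼ, Vⱼ⟫` on a space `S` of pairs
`(u, (u₁, …, uₘ))`, below the bottom `c` of the Rayleigh quotient. -/
theorem exists_resolvent_of_lt {L ι : Type*} [Fintype ι]
    [NormedAddCommGroup L] [InnerProductSpace ℝ L] [CompleteSpace L]
    (S : Submodule ℝ (L × (ι → L))) (hS : IsClosed (S : Set (L × (ι → L))))
    {c l : ℝ} (hc : 0 ≤ c) (hl : l < c)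
    (hP : ∀ U ∈ S, c * ‖U.1‖ ^ 2 ≤ ∑ j, ‖U.2 j‖ ^ 2) :
    ∃ R : L →L[ℝ] L,
      (∀ f, ∃ U ∈ S, U.1 = R f ∧
        ∀ V ∈ S, ∑ j, inner ℝ (V.2 j) (U.2 j) = inner ℝ V.1 (f + l • R f)) ∧
      ∀ w, ∀ U ∈ S, (∀ V ∈ S, ∑ j, inner ℝ (V.2 j) (U.2 j) = inner ℝ V.1 w) →
        R (w - l • U.1) = U.1 := by
  exact exists_resolvent_of_lt_of_equiv
    ((WithLp.prodContinuousLinearEquiv 2 ℝ L (PiLp 2 (fun _ : ι => L))).trans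
      ((ContinuousLinearEquiv.refl ℝ L).prodCongr
        (PiLp.continuousLinearEquiv 2 ℝ (fun _ : ι => L))))
    (fun v => (WithLp.prod_norm_sq_eq_of_L2 v).trans
      (congrArg _ (PiLp.norm_sq_eq_of_L2 (fun _ : ι => L) v.snd))) S hS hc hl hP

set_option linter.unusedSectionVars false

/-! ### Sard's theorem for smooth real functions. -/

section Sard

theorem natCast_lt_infty (k : ℕ) : (k : ℕ∞ω) < (∞ : ℕ∞ω) := by exact_mod_cast ENat.natCast_lt_top k

/-- A scalar partial derivative of order `k` which has nonzero differential where the derivative of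
order `k + 1` does not vanish. -/
theorem exists_partial_fderiv_ne_zero {E : Type*} [NormedAddCommGroup E] [NormedSpace ℝ E]
    {f : E → ℝ} {x : E} {k : ℕ} (hx : ContDiffAt ℝ ∞ f x)
    (hne : iteratedFDeriv ℝ (k + 1) f x ≠ 0) :
    ∃ v : Fin k → E, fderiv ℝ (fun y => iteratedFDeriv ℝ k f y v) x ≠ 0 := by
  obtain ⟨v, hv⟩ := DFunLike.ne_iff.1 hne
  refine ⟨Fin.tail v, fun h0 => hv ?_⟩
  have hd : DifferentiableAt ℝ (iteratedFDeriv ℝ k f) x :=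
    hx.differentiableAt_iteratedFDeriv (natCast_lt_infty k)
  rw [iteratedFDeriv_succ_apply_left, ← fderiv_continuousMultilinear_apply_const_apply hd, h0]
  rfl

/-- A Taylor estimate by descent from order `N + 1`: each use of the mean value inequality lowers
the order of the derivative by one and gains a factor `r`, because the lower derivative vanishes at
`x`. -/
theorem norm_iteratedFDeriv_le_of_vanish {E : Type*} [NormedAddCommGroup E] [NormedSpace ℝ E]
    {f : E → ℝ} {B : Set E} (hB : Convex ℝ B) {N : ℕ} {K : ℝ}
    (hf : ∀ y ∈ B, ContDiffAt ℝ ∞ f y) (hK : ∀ y ∈ B, ‖iteratedFDeriv ℝ (N + 1) f y‖ ≤ K)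
    {x : E} (hx : x ∈ B) (hz : ∀ j, 1 ≤ j → j ≤ N → iteratedFDeriv ℝ j f x = 0) {r : ℝ}
    (i : ℕ) (hi : i ≤ N) :
    ∀ y ∈ B, ‖y - x‖ ≤ r → ‖iteratedFDeriv ℝ (N + 1 - i) f y‖ ≤ K * r ^ i := by
  induction i with
  | zero => simpa using fun y hy _ => hK y hy
  | succ i ih =>
    intro y hy hyr
    have hr : 0 ≤ r := (norm_nonneg _).trans hyr
    have hK0 : 0 ≤ K := (norm_nonneg _).trans (hK x hx)
    have hconv : Convex ℝ (B ∩ Metric.closedBall x r) := hB.inter (convex_closedBall x r)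
    have hmem : ∀ z ∈ B ∩ Metric.closedBall x r, ‖z - x‖ ≤ r := fun z hz => by
      simpa [dist_eq_norm] using hz.2
    have hidx : N + 1 - i = (N + 1 - (i + 1)) + 1 := by omega
    have key := hconv.norm_image_sub_le_of_norm_fderiv_le (𝕜 := ℝ)
      (f := iteratedFDeriv ℝ (N + 1 - (i + 1)) f) (C := K * r ^ i)
      (fun z hz => (hf z hz.1).differentiableAt_iteratedFDeriv (natCast_lt_infty _))
      (fun z hz => by
        rw [norm_fderiv_iteratedFDeriv, ← hidx]
        exact ih (by omega) z hz.1 (hmem z hz))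
      (x := x) (y := y) ⟨hx, by simpa using hr⟩ ⟨hy, by simpa [dist_eq_norm] using hyr⟩
    rw [hz _ (by omega) (by omega), sub_zero] at key
    refine key.trans ?_
    rw [pow_succ, ← mul_assoc]
    exact mul_le_mul_of_nonneg_left hyr (by positivity)

/-- The last descent, from order one to order zero, stands apart because `f x` itself need not
vanish. -/
theorem abs_sub_le_of_iteratedFDeriv_vanish {E : Type*} [NormedAddCommGroup E] [NormedSpace ℝ E]
    {f : E → ℝ} {B : Set E} (hB : Convex ℝ B) {N : ℕ} {K : ℝ}
    (hf : ∀ y ∈ B, ContDiffAt ℝ ∞ f y) (hK : ∀ y ∈ B, ‖iteratedFDeriv ℝ (N + 1) f y‖ ≤ K)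
    {x : E} (hx : x ∈ B) (hz : ∀ j, 1 ≤ j → j ≤ N → iteratedFDeriv ℝ j f x = 0)
    {y : E} (hy : y ∈ B) : |f y - f x| ≤ K * ‖y - x‖ ^ (N + 1) := by
  have h1 := norm_iteratedFDeriv_le_of_vanish hB hf hK hx hz (r := ‖y - x‖) N le_rfl
  have hconv : Convex ℝ (B ∩ Metric.closedBall x ‖y - x‖) := hB.inter (convex_closedBall x _)
  have key := hconv.norm_image_sub_le_of_norm_fderiv_le (𝕜 := ℝ) (f := f) (C := K * ‖y - x‖ ^ N)
    (fun z hz => (hf z hz.1).differentiableAt (by simp))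
    (fun z hz => by
      have h2 := h1 z hz.1 (by simpa [dist_eq_norm] using hz.2)
      rwa [Nat.add_sub_cancel_left, ← zero_add 1, ← norm_fderiv_iteratedFDeriv,
        norm_fderiv_iteratedFDeriv, zero_add, norm_iteratedFDeriv_one] at h2)
    (x := x) (y := y) ⟨hx, by simp⟩ ⟨hy, by simp [dist_eq_norm]⟩
  rw [pow_succ, ← mul_assoc]
  exact key

theorem volume_image_null_of_locally {X : Type*} [TopologicalSpace X] [SecondCountableTopology X]
    {f : X → ℝ} {A : Set X} (h : ∀ x ∈ A, ∃ V ∈ 𝓝 x, volume (f '' (V ∩ A)) = 0) :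
    volume (f '' A) = 0 := by
  choose! V hV hnull using h
  obtain ⟨t, htA, htc, hcov⟩ := TopologicalSpace.countable_cover_nhdsWithin (f := V) (s := A)
    (fun x hx => mem_nhdsWithin_of_mem_nhds (hV x hx))
  have hsub : f '' A ⊆ ⋃ x ∈ t, f '' (V x ∩ A) := by
    rintro _ ⟨y, hy, rfl⟩
    obtain ⟨x, hx, hyx⟩ := mem_iUnion₂.1 (hcov hy)
    exact mem_iUnion₂.2 ⟨x, hx, mem_image_of_mem f ⟨hyx, hy⟩⟩
  exact measure_mono_null hsub ((measure_biUnion_null_iff htc).2 fun x hx => hnull x (htA hx))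

variable {E : Type*} [NormedAddCommGroup E] [NormedSpace ℝ E] [FiniteDimensional ℝ E]

/-- With `d` the dimension, `f` is locally Hölder of exponent `d + 2` on the flat set. Its image
there has Hausdorff dimension at most `d / (d + 2) < 1`, hence length zero. -/
theorem volume_image_flat_eq_zero {f : E → ℝ} {U : Set E} (hU : IsOpen U)
    (hf : ∀ x ∈ U, ContDiffAt ℝ ∞ f x) :
    volume (f '' {x ∈ U | ∀ j, 1 ≤ j → j ≤ Module.finrank ℝ E + 1 →
      iteratedFDeriv ℝ j f x = 0}) = 0 := by
  set N := Module.finrank ℝ E + 1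
  refine volume_image_null_of_locally fun x hx => ?_
  have hcont : ContinuousAt (fun y => ‖iteratedFDeriv ℝ (N + 1) f y‖) x :=
    ((hf x hx.1).iteratedFDeriv_right (m := 0) (i := N + 1)
      (by exact_mod_cast le_top)).continuousAt.norm
  set K := ‖iteratedFDeriv ℝ (N + 1) f x‖ + 1
  have hK : ∀ᶠ y in 𝓝 x, ‖iteratedFDeriv ℝ (N + 1) f y‖ ≤ K ∧ y ∈ U :=
    ((hcont.eventually_lt_const (u := K) (lt_add_one _)).mono fun y hy => hy.le).and
      (hU.mem_nhds hx.1)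
  obtain ⟨R, hR, hball⟩ := Metric.eventually_nhds_iff_ball.1 hK
  refine ⟨Metric.ball x R, Metric.ball_mem_nhds x hR, ?_⟩
  set s := Metric.ball x R ∩ {x ∈ U | ∀ j, 1 ≤ j → j ≤ N → iteratedFDeriv ℝ j f x = 0}
  have hK0 : 0 ≤ K := by positivity
  have hH : HolderOnWith K.toNNReal (N + 1 : ℕ) f s := by
    intro y hy z hz
    have := abs_sub_le_of_iteratedFDeriv_vanish (convex_ball x R) (fun y hy => hf y (hball y hy).2)
      (fun y hy => (hball y hy).1) hz.1 hz.2.2 hy.1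
    rw [edist_dist, edist_dist, Real.dist_eq, dist_eq_norm, NNReal.coe_natCast,
      ENNReal.rpow_natCast, ← ENNReal.ofReal_pow (norm_nonneg _), ← ENNReal.ofReal_coe_nnreal,
      Real.coe_toNNReal K hK0, ← ENNReal.ofReal_mul hK0]
    exact ENNReal.ofReal_le_ofReal this
  have h1 := hH.dimH_image_le (by positivity)
  have h2 : dimH s ≤ Module.finrank ℝ E :=
    (dimH_mono (subset_univ s)).trans (Real.dimH_univ_eq_finrank E).le
  have h3 : dimH (f '' s) < 1 := by
    refine (h1.trans (ENNReal.div_le_div_right h2 _)).trans_lt ?_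
    rw [ENNReal.div_lt_iff (by simp) (by simp)]
    simp only [one_mul, N]
    norm_cast
    omega
  have h4 := hausdorffMeasure_of_dimH_lt (d := 1) (by simpa using h3)
  rwa [NNReal.coe_one, hausdorffMeasure_real] at h4

/-- Near `x₀` the zero set of `w` is a hypersurface. Straightened to a piece of the hyperplane `ker
w'`, it carries the critical points of `f` to critical points of a function on a proper subspace,
where `ih` applies. -/
theorem volume_image_critical_hypersurface_eq_zero
    (ih : ∀ (F : Submodule ℝ E), F ≠ ⊤ → ∀ (g : F → ℝ) (U : Set F), IsOpen U →
      (∀ x ∈ U, ContDiffAt ℝ ∞ g x) → volume (g '' {x ∈ U | fderiv ℝ g x = 0}) = 0)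
    {f w : E → ℝ} {U : Set E} (hU : IsOpen U)
    (hf : ∀ x ∈ U, ContDiffAt ℝ ∞ f x) (hw : ∀ x ∈ U, ContDiffAt ℝ ∞ w x)
    {x₀ : E} (hx₀ : x₀ ∈ U) (hw₀ : fderiv ℝ w x₀ ≠ 0) :
    ∃ V ∈ 𝓝 x₀, volume (f '' (V ∩ {x ∈ U | w x = 0 ∧ fderiv ℝ f x = 0})) = 0 := by
  set w' := fderiv ℝ w x₀
  obtain ⟨e, he⟩ : ∃ e, w' e = 1 := by
    obtain ⟨v, hv⟩ := DFunLike.ne_iff.1 hw₀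
    exact ⟨(w' v)⁻¹ • v, by simpa using inv_mul_cancel₀ hv⟩
  -- Since `w' e = 1`, this map satisfies `w' ∘ Φ = w`, and its derivative at `x₀` is the identity.
  -- It is thus a local diffeomorphism sending `{w = 0}` into `ker w'`.
  let Φ : E → E := fun x => x + (w x - w' x) • e
  have hΦd : ∀ x ∈ U, HasFDerivAt Φ
      (ContinuousLinearMap.id ℝ E + (fderiv ℝ w x - w').smulRight e) x := fun x hx =>
    (hasFDerivAt_id x).add
      ((((hw x hx).differentiableAt (by simp)).hasFDerivAt.sub w'.hasFDerivAt).smul_const e)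
  have hΦs : ∀ x ∈ U, ContDiffAt ℝ ∞ Φ x := fun x hx =>
    contDiffAt_id.add (((hw x hx).sub w'.contDiff.contDiffAt).smul contDiffAt_const)
  have hwΦ : ∀ x, w' (Φ x) = w x := fun x => by simp [Φ, he]
  have hd₀ : HasFDerivAt Φ ((ContinuousLinearEquiv.refl ℝ E : E ≃L[ℝ] E) : E →L[ℝ] E) x₀ := by
    have := hΦd x₀ hx₀
    simp only [w', sub_self] at this
    convert this using 1
    ext; simp
  let h := (hΦs x₀ hx₀).toOpenPartialHomeomorph Φ hd₀ (by simp)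
  have hh : ∀ x, h x = Φ x := fun x => rfl
  have hcont : ContinuousAt (fderiv ℝ Φ) x₀ :=
    ((hΦs x₀ hx₀).fderiv_right (m := 0) (by simp)).continuousAt
  -- Smoothness of the local inverse is obtained point by point, so the derivative of `Φ` must be
  -- invertible on a whole neighbourhood.
  have hinv : ∀ᶠ x in 𝓝 x₀, fderiv ℝ Φ x ∈ range ((↑) : (E ≃L[ℝ] E) → E →L[ℝ] E) :=
    hcont.eventually_mem (by rw [hd₀.fderiv]; exact ContinuousLinearEquiv.nhds _)
  obtain ⟨V, hVsub, hVo, hxV⟩ := mem_nhds_iff.1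
    (hinv.and ((hU.eventually_mem hx₀).and
      (h.open_source.eventually_mem ((hΦs x₀ hx₀).mem_toOpenPartialHomeomorph_source hd₀ (by simp)))))
  have hVs : V ⊆ h.source := fun x hx => (hVsub hx).2.2
  let F : Submodule ℝ E := LinearMap.ker (w' : E →ₗ[ℝ] ℝ)
  have hF : F ≠ ⊤ := fun hF => by
    have : e ∈ F := hF ▸ Submodule.mem_top
    simp [F, he] at this
  let g : F → ℝ := fun y => f (h.symm y)
  let T : Set E := h.target ∩ h.symm ⁻¹' V
  have hT : IsOpen T := h.isOpen_inter_preimage_symm hVo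
  have hsymm : ∀ y ∈ T, ContDiffAt ℝ ∞ h.symm y := fun y hy => by
    obtain ⟨L, hL⟩ := (hVsub hy.2).1
    refine h.contDiffAt_symm (f₀' := L) hy.1 ?_ (hΦs _ (hVsub hy.2).2.1)
    rw [hL]
    exact (hΦd _ (hVsub hy.2).2.1).differentiableAt.hasFDerivAt
  have hgs : ∀ y ∈ ((↑) : F → E) ⁻¹' T, ContDiffAt ℝ ∞ g y := fun y hy =>
    ((hf _ (hVsub hy.2).2.1).comp (y : E) (hsymm _ hy)).comp y F.subtypeL.contDiff.contDiffAt
  have hnull := ih F hF g _ (hT.preimage continuous_subtype_val) hgs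
  refine ⟨V, hVo.mem_nhds hxV, measure_mono_null ?_ hnull⟩
  rintro _ ⟨x, ⟨hxV, hxU, hwx, hfx⟩, rfl⟩
  have hxF : Φ x ∈ F := by simp [F, hwΦ, hwx]
  have hl : h.symm (Φ x) = x := h.left_inv (hVs hxV)
  have hxT : Φ x ∈ T := ⟨h.map_source (hVs hxV), by simpa [hl] using hxV⟩
  refine ⟨⟨Φ x, hxF⟩, ⟨hxT, ?_⟩, by simp [g, hl]⟩
  have h1 : HasFDerivAt f (0 : E →L[ℝ] ℝ) (h.symm (Φ x)) := by
    rw [hl, ← hfx]; exact ((hf x hxU).differentiableAt (by simp)).hasFDerivAt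
  have h2 := ((hsymm _ hxT).differentiableAt (by simp)).hasFDerivAt
  have h3 := (h1.comp (Φ x) h2).comp (⟨Φ x, hxF⟩ : F) F.subtypeL.hasFDerivAt
  have h4 : HasFDerivAt g (0 : F →L[ℝ] ℝ) ⟨Φ x, hxF⟩ := by
    rw [ContinuousLinearMap.zero_comp, ContinuousLinearMap.zero_comp] at h3
    exact h3
  exact h4.fderiv

/-- Sard's theorem for real functions. -/
theorem volume_image_critical_eq_zero (n : ℕ) : ∀ (E : Type*) [NormedAddCommGroup E]
    [NormedSpace ℝ E] [FiniteDimensional ℝ E], Module.finrank ℝ E = n →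
    ∀ (f : E → ℝ) (U : Set E), IsOpen U → (∀ x ∈ U, ContDiffAt ℝ ∞ f x) →
      volume (f '' {x ∈ U | fderiv ℝ f x = 0}) = 0 := by
  induction n using Nat.strong_induction_on with
  | _ n ih =>
  intro E _ _ _ hn f U hU hf
  -- The critical set lies in `Z 1`. On `Z k \ Z (k + 1)` some partial derivative of order `k`
  -- vanishes with nonzero differential, which puts the points on a hypersurface and allows
  -- induction on the dimension. What remains at the end is the flat set `Z (n + 1)`.
  let Z : ℕ → Set E := fun k => {x ∈ U | ∀ j, 1 ≤ j → j ≤ k → iteratedFDeriv ℝ j f x = 0}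
  have hZ1 : ∀ x ∈ U, fderiv ℝ f x = 0 → x ∈ Z 1 := fun x hx h0 => by
    refine ⟨hx, fun j h1 h2 => ?_⟩
    obtain rfl : j = 1 := by omega
    rw [← norm_eq_zero, norm_iteratedFDeriv_one, h0, norm_zero]
  have hF : ∀ (F : Submodule ℝ E), F ≠ ⊤ → ∀ (g : F → ℝ) (U : Set F), IsOpen U →
      (∀ x ∈ U, ContDiffAt ℝ ∞ g x) → volume (g '' {x ∈ U | fderiv ℝ g x = 0}) = 0 := by
    intro F hF g U hU hg
    have hlt : Module.finrank ℝ F < n := by rw [← hn]; exact Submodule.finrank_lt hF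
    exact ih _ hlt F rfl g U hU hg
  have hstrat : ∀ k, 1 ≤ k → volume (f '' (Z k \ Z (k + 1))) = 0 := fun k hk => by
    refine volume_image_null_of_locally fun x hx => ?_
    have hne : iteratedFDeriv ℝ (k + 1) f x ≠ 0 := fun h0 => hx.2 ⟨hx.1.1, fun j h1 h2 => by
      rcases Nat.lt_or_ge j (k + 1) with h | h
      · exact hx.1.2 j h1 (by omega)
      · obtain rfl : j = k + 1 := by omega
        exact h0⟩
    obtain ⟨v, hw₀⟩ := exists_partial_fderiv_ne_zero (hf x hx.1.1) hne
    have hw : ∀ y ∈ U, ContDiffAt ℝ ∞ (fun y => iteratedFDeriv ℝ k f y v) y := fun y hy =>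
      (ContinuousMultilinearMap.apply ℝ (fun _ : Fin k => E) ℝ v).contDiff.contDiffAt.comp y
        ((hf y hy).iteratedFDeriv_right (m := ∞) (i := k) (by exact_mod_cast le_top))
    obtain ⟨V, hV, hnull⟩ := volume_image_critical_hypersurface_eq_zero hF hU hf hw hx.1.1 hw₀
    refine ⟨V, hV, measure_mono_null (image_mono ?_) hnull⟩
    rintro y ⟨hyV, hyZ, -⟩
    refine ⟨hyV, hyZ.1, ?_, ?_⟩
    · simp [hyZ.2 k hk le_rfl]
    · rw [← norm_eq_zero, ← norm_iteratedFDeriv_one, hyZ.2 1 le_rfl hk, norm_zero]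
  have hflat : volume (f '' Z (n + 1)) = 0 := by
    have := volume_image_flat_eq_zero hU hf
    rwa [hn] at this
  -- The strata are added from the flat end: the index `n + 1 - k` descends from `n + 1` to `1`.
  have hall : ∀ k, k ≤ n → volume (f '' Z (n + 1 - k)) = 0 := fun k => by
    induction k with
    | zero => exact fun _ => hflat
    | succ k ihk =>
      intro hk
      have hidx : n + 1 - k = n + 1 - (k + 1) + 1 := by omega
      have h1 := hstrat (n + 1 - (k + 1)) (by omega)
      have h2 := ihk (by omega)
      rw [hidx] at h2
      refine measure_mono_null ?_ (measure_union_null h1 h2)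
      rw [← image_union]
      refine image_mono fun x hx => ?_
      by_cases h : x ∈ Z (n + 1 - (k + 1) + 1)
      · exact Or.inr h
      · exact Or.inl ⟨hx, h⟩
  have h1 := hall n le_rfl
  rw [Nat.add_sub_cancel_left] at h1
  exact measure_mono_null (image_mono fun x hx => hZ1 x hx.1 hx.2) h1

end Sard

/-! ### Derivative of the determinant and the Piola identity. -/

section Piola

theorem two_le_infty : (2 : ℕ∞ω) ≤ (∞ : ℕ∞ω) := (natCast_lt_infty 2).le

variable {E : Type*} [NormedAddCommGroup E] [NormedSpace ℝ E] [FiniteDimensional ℝ E]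

theorem ContinuousLinearMap.differentiable_det :
    Differentiable ℝ (fun L : E →L[ℝ] E => L.det) := by
  let b := Module.finBasis ℝ E
  have hentry : ∀ i j, ContDiff ℝ 1 fun L : E →L[ℝ] E => LinearMap.toMatrix b b L i j := by
    intro i j
    have : (fun L : E →L[ℝ] E => LinearMap.toMatrix b b L i j) =
        fun L => LinearMap.toContinuousLinearMap (b.coord i) (L (b j)) := by
      ext L; simp [LinearMap.toMatrix_apply]
    rw [this]
    fun_prop
  have : (fun L : E →L[ℝ] E => L.det) =
      fun L : E →L[ℝ] E => (LinearMap.toMatrix b b (L : E →ₗ[ℝ] E)).det := by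
    ext L; rw [LinearMap.det_toMatrix]
  rw [this]
  simp only [Matrix.det_apply]
  refine (ContDiff.sum fun σ _ => ContDiff.const_smul _ ?_).differentiable one_ne_zero
  exact contDiff_prod fun i _ => hentry (σ i) i

/-- Differentiability is known, so derivatives along the lines `1 + t H` suffice; there `det (1 + t
H) = 1 + t tr H + t² q(t)` with a polynomial `q`. -/
theorem ContinuousLinearMap.hasFDerivAt_det_id :
    HasFDerivAt (fun L : E →L[ℝ] E => L.det)
      (LinearMap.toContinuousLinearMap (LinearMap.trace ℝ E ∘ₗ ContinuousLinearMap.coeLM ℝ))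
      (ContinuousLinearMap.id ℝ E) := by
  have hd := (differentiable_det (E := E) (ContinuousLinearMap.id ℝ E)).hasFDerivAt
  convert hd using 1
  ext H
  have hline : HasDerivAt (fun t : ℝ => ContinuousLinearMap.id ℝ E + t • H) H 0 := by
    simpa using ((hasDerivAt_id (0 : ℝ)).smul_const H).const_add (ContinuousLinearMap.id ℝ E)
  have h1 : HasDerivAt (fun t : ℝ => (ContinuousLinearMap.id ℝ E + t • H).det)
      (fderiv ℝ (fun L : E →L[ℝ] E => L.det) (ContinuousLinearMap.id ℝ E) H) 0 := by
    have hd' : HasFDerivAt (fun L : E →L[ℝ] E => L.det)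
        (fderiv ℝ (fun L : E →L[ℝ] E => L.det) (ContinuousLinearMap.id ℝ E))
        (ContinuousLinearMap.id ℝ E + (0 : ℝ) • H) := by simpa using hd
    exact hd'.comp_hasDerivAt (0 : ℝ) hline
  let b := Module.finBasis ℝ E
  have h2 : HasDerivAt (fun t : ℝ => (ContinuousLinearMap.id ℝ E + t • H).det)
      (LinearMap.trace ℝ E H) 0 := by
    have hM : ∀ t : ℝ, (ContinuousLinearMap.id ℝ E + t • H).det =
        (1 + t • LinearMap.toMatrix b b (H : E →ₗ[ℝ] E)).det := fun t => by
      rw [ContinuousLinearMap.det, ← LinearMap.det_toMatrix b]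
      simp
    rw [LinearMap.trace_eq_matrix_trace ℝ b, funext hM,
      funext fun t : ℝ => Matrix.det_one_add_smul t (LinearMap.toMatrix b b (H : E →ₗ[ℝ] E))]
    have hp : ∀ q : Polynomial ℝ, HasDerivAt (fun t : ℝ =>
        1 + (LinearMap.toMatrix b b (H : E →ₗ[ℝ] E)).trace * t + q.eval t * t ^ 2)
        (LinearMap.toMatrix b b (H : E →ₗ[ℝ] E)).trace 0 := fun q => by
      have h3 := (((hasDerivAt_id (0 : ℝ)).const_mul
        (LinearMap.toMatrix b b (H : E →ₗ[ℝ] E)).trace).const_add 1).add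
        ((q.hasDerivAt 0).mul ((hasDerivAt_id (0 : ℝ)).pow 2))
      convert! h3 using 1
      simp
    exact hp _
  exact h2.unique h1

/-- Jacobi's formula, reduced to the identity by `det L = det A · det (A⁻¹ L)`. -/
theorem ContinuousLinearMap.hasFDerivAt_det (A : E ≃L[ℝ] E) :
    HasFDerivAt (fun L : E →L[ℝ] E => L.det)
      ((A : E →L[ℝ] E).det • (LinearMap.toContinuousLinearMap
        (LinearMap.trace ℝ E ∘ₗ ContinuousLinearMap.coeLM ℝ) ∘L
          ContinuousLinearMap.compL ℝ E E E (A.symm : E →L[ℝ] E))) (A : E →L[ℝ] E) := by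
  have h1 : (fun L : E →L[ℝ] E => L.det) =
      fun L => (A : E →L[ℝ] E).det * ((A.symm : E →L[ℝ] E) ∘L L).det := by
    ext L
    have : L = (A : E →L[ℝ] E) ∘L ((A.symm : E →L[ℝ] E) ∘L L) := by ext; simp
    conv_lhs => rw [this]
    exact LinearMap.det_comp _ _
  have h2 : HasFDerivAt (fun L : E →L[ℝ] E => (A.symm : E →L[ℝ] E) ∘L L)
      (ContinuousLinearMap.compL ℝ E E E (A.symm : E →L[ℝ] E)) (A : E →L[ℝ] E) :=
    (ContinuousLinearMap.compL ℝ E E E (A.symm : E →L[ℝ] E)).hasFDerivAt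
  rw [h1]
  refine HasFDerivAt.const_mul (HasFDerivAt.comp (A : E →L[ℝ] E) (f := fun L : E →L[ℝ] E =>
    (A.symm : E →L[ℝ] E) ∘L L) (g := fun L : E →L[ℝ] E => L.det) ?_ h2) _
  rw [ContinuousLinearEquiv.coe_symm_comp_coe]
  exact hasFDerivAt_det_id

/-- The Piola identity: the divergence of the pullback of a vector density. -/
theorem trace_fderiv_piola {τ G : E → E} {y : E} (hτ : ContDiffAt ℝ ∞ τ y) (A : E ≃L[ℝ] E) (hA : fderiv ℝ τ y = A)
    (hG : DifferentiableAt ℝ G (τ y)) :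
    LinearMap.trace ℝ E (fderiv ℝ (fun z =>
      (fderiv ℝ τ z).det • (fderiv ℝ τ z).inverse (G (τ z))) y : E →ₗ[ℝ] E) =
      (A : E →L[ℝ] E).det * LinearMap.trace ℝ E (fderiv ℝ G (τ y) : E →ₗ[ℝ] E) := by
  let T := fderiv ℝ τ
  have hTd : HasFDerivAt T (fderiv ℝ T y) y :=
    ((hτ.fderiv_right (m := 1) (one_add_one_eq_two.trans_le two_le_infty)).differentiableAt
      (by simp)).hasFDerivAt
  have hτd : HasFDerivAt τ (A : E →L[ℝ] E) y :=
    hA ▸ (hτ.differentiableAt (by simp)).hasFDerivAt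
  set J := (A : E →L[ℝ] E).det
  let K : E → E := fun z => (T z).inverse (G (τ z))
  have hinvd : DifferentiableAt ℝ (fun z => (T z).inverse) y := by
    have h1 : DifferentiableAt ℝ (ContinuousLinearMap.inverse : (E →L[ℝ] E) → E →L[ℝ] E) (T y) := by
      have := contDiffAt_map_inverse (𝕜 := ℝ) (n := 1) A
      rw [← hA] at this
      exact this.differentiableAt (by simp)
    exact h1.comp y hTd.differentiableAt
  have hKd : HasFDerivAt K (fderiv ℝ K y) y :=
    (hinvd.clm_apply (hG.comp y hτd.differentiableAt)).hasFDerivAt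
  have hinv : ∀ᶠ z in 𝓝 y, T z (K z) = G (τ z) := by
    have h1 : ∀ᶠ z in 𝓝 y, T z ∈ range ((↑) : (E ≃L[ℝ] E) → E →L[ℝ] E) :=
      hTd.continuousAt.eventually_mem (by
        rw [show T y = (A : E →L[ℝ] E) from hA]; exact ContinuousLinearEquiv.nhds _)
    filter_upwards [h1] with z ⟨B, hB⟩
    simp only [K, ← hB, ContinuousLinearMap.inverse_equiv]
    exact B.apply_symm_apply _
  -- This is the derivative of `T z (K z) = G (τ z)`; it expresses `fderiv K` without
  -- differentiating the inverse explicitly.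
  have hderK : ∀ v, fderiv ℝ T y v (K y) + A (fderiv ℝ K y v) = fderiv ℝ G (τ y) (A v) := by
    intro v
    have h1 := (hTd.clm_apply hKd).congr_of_eventuallyEq (hinv.mono fun z hz => hz.symm)
    have h2 := hG.hasFDerivAt.comp y hτd
    have h3 := DFunLike.congr_fun (h1.unique h2) v
    have h4 : T y = (A : E →L[ℝ] E) := hA
    simp only [add_apply, ContinuousLinearMap.comp_apply,
      ContinuousLinearMap.flip_apply, h4, ContinuousLinearEquiv.coe_coe] at h3
    rw [← h3, add_comm]
  have hJd := (ContinuousLinearMap.hasFDerivAt_det A)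
  rw [← hA] at hJd
  have hJ := HasFDerivAt.comp y hJd hTd
  have hF := (hJ.smul hKd).fderiv
  have hsymm : ∀ v w, fderiv ℝ T y v w = fderiv ℝ T y w v :=
    hτ.isSymmSndFDerivAt (by
      rw [minSmoothness_of_isRCLikeNormedField]; exact two_le_infty)
  let a : E →ₗ[ℝ] E := (A.symm : E →L[ℝ] E)
  let φ : E →ₗ[ℝ] ℝ := J • (LinearMap.trace ℝ E ∘ₗ (LinearMap.llcomp ℝ E E E a) ∘ₗ
    ContinuousLinearMap.coeLM ℝ ∘ₗ (fderiv ℝ T y : E →ₗ[ℝ] E →L[ℝ] E))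
  -- The first term is conjugate to `fderiv G` and has its trace. By symmetry of the second
  -- derivative of `τ`, the second term has trace `φ (K y)`, which is also the trace of the rank-one
  -- term; these two cancel.
  have hdec : (fderiv ℝ (fun z => (T z).det • (T z).inverse (G (τ z))) y : E →ₗ[ℝ] E) =
      J • (A.toLinearEquiv.symm.conj (fderiv ℝ G (τ y) : E →ₗ[ℝ] E)) -
        J • (a ∘ₗ (fderiv ℝ T y (K y) : E →ₗ[ℝ] E)) + φ.smulRight (K y) := by
    ext v
    have h1 : fderiv ℝ K y v = A.symm (fderiv ℝ G (τ y) (A v)) - A.symm (fderiv ℝ T y (K y) v) := by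
      rw [← hderK, map_add, hsymm, A.symm_apply_apply]; abel
    have h2 := DFunLike.congr_fun hF v
    refine h2.trans ?_
    change (fderiv ℝ τ y).det • fderiv ℝ K y v + ((fderiv ℝ τ y).det *
      LinearMap.trace ℝ E ((A.symm : E →L[ℝ] E) ∘L fderiv ℝ T y v : E →L[ℝ] E)) • K y =
      J • A.symm (fderiv ℝ G (τ y) (A v)) - J • A.symm (fderiv ℝ T y (K y) v) +
      (J * LinearMap.trace ℝ E ((A.symm : E →L[ℝ] E) ∘L fderiv ℝ T y v : E →L[ℝ] E)) • K y
    rw [hA, h1, smul_sub]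
  rw [hdec, map_add, map_sub, map_smul, map_smul, LinearMap.trace_conj', LinearMap.trace_smulRight]
  exact sub_add_cancel _ _

end Piola

/-! ### Changes of charts: transformation of densities and vector fields. -/

namespace CC

section Charts

variable {n m : ℕ} {M : Type*} [TopologicalSpace M] [ChartedSpace (Model n) M]

/-- The components of a vector field in the preferred chart at `p`. -/
noncomputable def coordField (V : (p : M) → TangentSpace (𝓡 n) p) (p : M) : Model n → Model n := fun y =>
  VectorField.mpullback 𝓘(ℝ, Model n) (𝓡 n) (extChartAt (𝓡 n) p).symm V y

variable (n) in
/-- The change of coordinates from the preferred chart at `p` to the one at `q`. -/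
noncomputable def transition (p q : M) : Model n → Model n :=
  extChartAt (𝓡 n) q ∘ (extChartAt (𝓡 n) p).symm

variable (n) in
/-- The domain of `transition n p q`. -/
noncomputable def overlap (p q : M) : Set (Model n) :=
  (extChartAt (𝓡 n) p).target ∩ (extChartAt (𝓡 n) p).symm ⁻¹' (extChartAt (𝓡 n) q).source

theorem isOpen_overlap (p q : M) : IsOpen (overlap n p q) :=
  (continuousOn_extChartAt_symm p).isOpen_inter_preimage (isOpen_extChartAt_target p)
    (isOpen_extChartAt_source q)

theorem transition_mem_target {p q : M} {y : Model n} (hy : y ∈ overlap n p q) :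
    transition n p q y ∈ (extChartAt (𝓡 n) q).target :=
  (extChartAt (𝓡 n) q).map_source hy.2

theorem symm_transition {p q : M} {y : Model n} (hy : y ∈ overlap n p q) :
    (extChartAt (𝓡 n) q).symm (transition n p q y) = (extChartAt (𝓡 n) p).symm y :=
  (extChartAt (𝓡 n) q).left_inv hy.2

theorem transition_transition {p q : M} {y : Model n} (hy : y ∈ overlap n p q) :
    transition n q p (transition n p q y) = y := by
  rw [transition, Function.comp_apply, symm_transition hy, (extChartAt (𝓡 n) p).right_inv hy.1]

variable [IsManifold (𝓡 n) ∞ M]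

theorem contDiffAt_transition {p q : M} {y : Model n} (hy : y ∈ overlap n p q) :
    ContDiffAt ℝ ∞ (transition n p q) y := by
  have h := contDiffOn_ext_coord_change (I := 𝓡 n) (n := ∞) q p
  have he : ((extChartAt (𝓡 n) p).symm ≫ extChartAt (𝓡 n) q).source = overlap n p q :=
    PartialEquiv.trans_source _ _
  rw [he] at h
  exact h.contDiffAt ((isOpen_overlap p q).mem_nhds hy)

theorem mdifferentiableAt_chart_symm {p : M} {y : Model n}
    (hy : y ∈ (extChartAt (𝓡 n) p).target) :
    MDifferentiableAt 𝓘(ℝ, Model n) (𝓡 n) (extChartAt (𝓡 n) p).symm y := by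
  have : IsManifold (𝓡 n) 1 M := IsManifold.of_le (n := ∞) (by simp)
  have h := mdifferentiableWithinAt_extChartAt_symm (I := 𝓡 n) hy
  rwa [ModelWithCorners.Boundaryless.range_eq_univ, mdifferentiableWithinAt_univ] at h

theorem isInvertible_mfderiv_chart_symm {p : M} {y : Model n}
    (hy : y ∈ (extChartAt (𝓡 n) p).target) :
    (mfderiv 𝓘(ℝ, Model n) (𝓡 n) (extChartAt (𝓡 n) p).symm y).IsInvertible := by
  have : IsManifold (𝓡 n) 1 M := IsManifold.of_le (n := ∞) (by simp)
  have h := isInvertible_mfderivWithin_extChartAt_symm (I := 𝓡 n) hy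
  rwa [ModelWithCorners.Boundaryless.range_eq_univ, mfderivWithin_univ] at h

/-- The derivative of the inverse chart at `p`. -/
noncomputable def chartFrame (p : M) (y : Model n) : Model n →L[ℝ] Model n :=
  mfderiv 𝓘(ℝ, Model n) (𝓡 n) (extChartAt (𝓡 n) p).symm y

theorem chartFrame_eq_comp {p q : M} {y : Model n} (hy : y ∈ overlap n p q) :
    chartFrame p y = chartFrame q (transition n p q y) ∘L fderiv ℝ (transition n p q) y := by
  have h1 : (extChartAt (𝓡 n) p).symm =ᶠ[𝓝 y]
      (extChartAt (𝓡 n) q).symm ∘ transition n p q := by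
    filter_upwards [(isOpen_overlap p q).mem_nhds hy] with z hz
    exact (symm_transition hz).symm
  have h2 : HasMFDerivAt 𝓘(ℝ, Model n) 𝓘(ℝ, Model n) (transition n p q) y
      (fderiv ℝ (transition n p q) y) :=
    ((contDiffAt_transition hy).differentiableAt (by simp)).hasFDerivAt.hasMFDerivAt
  have h3 := (mdifferentiableAt_chart_symm (transition_mem_target hy)).hasMFDerivAt
  have h4 := (h3.comp y h2).congr_of_eventuallyEq h1
  exact h4.mfderiv

theorem isInvertible_chartFrame {p : M} {y : Model n} (hy : y ∈ (extChartAt (𝓡 n) p).target) :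
    (chartFrame p y).IsInvertible := isInvertible_mfderiv_chart_symm hy

theorem isInvertible_fderiv_transition {p q : M} {y : Model n} (hy : y ∈ overlap n p q) :
    (fderiv ℝ (transition n p q) y).IsInvertible := by
  obtain ⟨A, hA⟩ := isInvertible_chartFrame hy.1
  obtain ⟨B, hB⟩ := isInvertible_chartFrame (transition_mem_target hy)
  have h := chartFrame_eq_comp hy
  refine ⟨A.trans B.symm, ?_⟩
  ext1 v
  have h2 : A v = B (fderiv ℝ (transition n p q) y v) := by
    have := DFunLike.congr_fun h v
    rw [← hA, ← hB] at this
    exact this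
  simp [h2]

theorem alternating_comp_eq_det_mul (f : Model n [⋀^Fin n]→ₗ[ℝ] ℝ) (L A : Model n →L[ℝ] Model n) :
    f (fun i => L (A (EuclideanSpace.single i 1))) =
      A.det * f (fun i => L (EuclideanSpace.single i 1)) := by
  let b := (EuclideanSpace.basisFun (Fin n) ℝ).toBasis
  have hb : ∀ i, b i = EuclideanSpace.single i 1 := fun i => by simp [b]
  let g : Model n [⋀^Fin n]→ₗ[ℝ] ℝ := f.compLinearMap (L : Model n →ₗ[ℝ] Model n)
  have h1 : f (fun i => L (A (EuclideanSpace.single i 1))) = g (A ∘ b) := by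
    simp [g, hb, Function.comp_def]
  have h2 : f (fun i => L (EuclideanSpace.single i 1)) = g b := by
    simp [g, hb]
  rw [h1, h2, g.eq_smul_basis_det b]
  have h3 : b.det (A ∘ b) = A.det * b.det b := b.det_comp (A : Model n →ₗ[ℝ] Model n) b
  simp [h3, Module.Basis.det_self, mul_comm]

theorem coordDensity_eq_det_mul (vf : (p : M) → TangentSpace (𝓡 n) p [⋀^Fin n]→ₗ[ℝ] ℝ)
    {p q : M} {y : Model n} (hy : y ∈ overlap n p q) :
    coordDensity vf p y =
      (fderiv ℝ (transition n p q) y).det * coordDensity vf q (transition n p q y) := by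
  -- The two base points are only propositionally equal. All tangent spaces unfold to `Model n`, so
  -- the comparison can be made on plain vectors.
  have h1 : ∀ x x' : M, x = x' → ∀ v : Fin n → Model n, vf x v = vf x' v := by
    rintro x _ rfl v; rfl
  have h2 : coordDensity vf p y = vf ((extChartAt (𝓡 n) q).symm (transition n p q y))
      (fun i => chartFrame p y (EuclideanSpace.single i 1)) :=
    h1 _ _ (symm_transition hy).symm _
  rw [h2, chartFrame_eq_comp hy]
  exact alternating_comp_eq_det_mul
    (vf ((extChartAt (𝓡 n) q).symm (transition n p q y))) _ _

/-- The coordinate frame is a basis of the tangent space, and a top-degree form that vanishes on a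
basis is zero. -/
theorem coordDensity_ne_zero {vf : (p : M) → TangentSpace (𝓡 n) p [⋀^Fin n]→ₗ[ℝ] ℝ}
    (hvf : ∀ p, vf p ≠ 0) {p : M} {y : Model n} (hy : y ∈ (extChartAt (𝓡 n) p).target) :
    coordDensity vf p y ≠ 0 := by
  obtain ⟨A, hA⟩ := isInvertible_chartFrame hy
  let b := (EuclideanSpace.basisFun (Fin n) ℝ).toBasis.map A.toLinearEquiv
  let g : Model n [⋀^Fin n]→ₗ[ℝ] ℝ := vf ((extChartAt (𝓡 n) p).symm y)
  have h1 : coordDensity vf p y = g b := by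
    have : ∀ i, b i = chartFrame p y (EuclideanSpace.single i 1) := fun i => by
      simp [b, ← hA]
    rw [funext this]; rfl
  intro h0
  refine hvf ((extChartAt (𝓡 n) p).symm y) ?_
  have : g = 0 := by
    rw [g.eq_smul_basis_det b, ← h1, h0, zero_smul]
  exact this

theorem coordField_eq_inverse (V : (p : M) → TangentSpace (𝓡 n) p)
    {p q : M} {y : Model n} (hy : y ∈ overlap n p q) :
    coordField V p y =
      (fderiv ℝ (transition n p q) y).inverse (coordField V q (transition n p q y)) := by
  have h1 : ∀ x x' : M, x = x' → (V x : Model n) = V x' := by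
    rintro x _ rfl; rfl
  have h2 : coordField V p y = (chartFrame p y).inverse
      (V ((extChartAt (𝓡 n) q).symm (transition n p q y)) : Model n) :=
    congrArg (chartFrame p y).inverse (h1 _ _ (symm_transition hy).symm)
  have h3 : coordField V q (transition n p q y) = (chartFrame q (transition n p q y)).inverse
      (V ((extChartAt (𝓡 n) q).symm (transition n p q y)) : Model n) := rfl
  obtain ⟨A, hA⟩ := isInvertible_fderiv_transition hy
  obtain ⟨B, hB⟩ := isInvertible_chartFrame (transition_mem_target hy)
  rw [h2, h3, chartFrame_eq_comp hy, ← hA, ← hB]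
  have : (B : Model n →L[ℝ] Model n) ∘L (A : Model n →L[ℝ] Model n) =
    ((A.trans B : Model n ≃L[ℝ] Model n) : Model n →L[ℝ] Model n) := rfl
  rw [this, ContinuousLinearMap.inverse_equiv, ContinuousLinearMap.inverse_equiv,
    ContinuousLinearMap.inverse_equiv]
  rfl

theorem contDiffAt_coordField {V : (p : M) → TangentSpace (𝓡 n) p}
    (hV : ContMDiff (𝓡 n) (𝓡 n).tangent ∞ (fun p => (⟨p, V p⟩ : TangentBundle (𝓡 n) M)))
    {p : M} {y : Model n} (hy : y ∈ (extChartAt (𝓡 n) p).target) :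
    ContDiffAt ℝ ∞ (coordField V p) y := by
  have h1 : ContMDiffAt 𝓘(ℝ, Model n) (𝓡 n) ∞ (extChartAt (𝓡 n) p).symm y :=
    (contMDiffOn_extChartAt_symm p).contMDiffAt ((isOpen_extChartAt_target p).mem_nhds hy)
  have h2 := ContMDiffAt.mpullback_vectorField_preimage (hV _) h1
    (isInvertible_mfderiv_chart_symm hy) (m := ∞) (by simp)
  exact contMDiffAt_vectorSpace_iff_contDiffAt.1 h2

end Charts

end CC

/-! ### Divergence and directional derivatives in one fixed chart. -/

namespace CC

section

variable {n m : ℕ} {M : Type*} [TopologicalSpace M] [ChartedSpace (Model n) M]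
  [IsManifold (𝓡 n) ∞ M]

namespace CCSpace

variable (C : CCSpace n m M)

theorem contDiffAt_coordDensity {p : M} {y : Model n} (hy : y ∈ (extChartAt (𝓡 n) p).target) :
    ContDiffAt ℝ ∞ (coordDensity C.form p) y :=
  (C.smooth_form p).contDiffAt ((isOpen_extChartAt_target p).mem_nhds hy)

/-- The vector density `ρ V` of a vector field `V` in the preferred chart at `p`. -/
noncomputable def vectorDensity (V : (p : M) → TangentSpace (𝓡 n) p) (p : M) (y : Model n) :
    Model n :=
  coordDensity C.form p y • coordField V p y

/-- The coordinate expression of the divergence in the preferred chart at `p`. -/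
noncomputable def coordDivergence (V : (p : M) → TangentSpace (𝓡 n) p) (p : M) (y : Model n) : ℝ :=
  (coordDensity C.form p y)⁻¹ *
    LinearMap.trace ℝ (Model n) (fderiv ℝ (C.vectorDensity V p) y : Model n →ₗ[ℝ] Model n)

variable {V : (p : M) → TangentSpace (𝓡 n) p}

theorem contDiffAt_vectorDensity
    (hV : ContMDiff (𝓡 n) (𝓡 n).tangent ∞ (fun p => (⟨p, V p⟩ : TangentBundle (𝓡 n) M)))
    {p : M} {y : Model n} (hy : y ∈ (extChartAt (𝓡 n) p).target) :
    ContDiffAt ℝ ∞ (C.vectorDensity V p) y :=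
  (C.contDiffAt_coordDensity hy).smul (contDiffAt_coordField hV hy)

/-- The divergence at `q` is defined in the chart preferred at `q`, which varies with `q`. By the
Piola identity the formula in a fixed chart gives the same value, the Jacobian cancelling against
the one in the density. Continuity and integration in a chart depend on this. -/
theorem divergence_eq_coordDivergence
    (hV : ContMDiff (𝓡 n) (𝓡 n).tangent ∞ (fun p => (⟨p, V p⟩ : TangentBundle (𝓡 n) M)))
    {p q : M} (hq : q ∈ (extChartAt (𝓡 n) p).source) :
    C.divergence V q = C.coordDivergence V p (extChartAt (𝓡 n) p q) := by
  set y := extChartAt (𝓡 n) p q with hy_def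
  have hsy : (extChartAt (𝓡 n) p).symm y = q := (extChartAt (𝓡 n) p).left_inv hq
  have hy : y ∈ overlap n p q :=
    ⟨(extChartAt (𝓡 n) p).map_source hq, by
      rw [mem_preimage, hsy]; exact mem_extChartAt_source q⟩
  have hτ : transition n p q y = extChartAt (𝓡 n) q q := by
    rw [transition, Function.comp_apply, hsy]
  obtain ⟨A, hA⟩ := isInvertible_fderiv_transition hy
  have hev : C.vectorDensity V p =ᶠ[𝓝 y] fun z => (fderiv ℝ (transition n p q) z).det •
      (fderiv ℝ (transition n p q) z).inverse (C.vectorDensity V q (transition n p q z)) := by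
    filter_upwards [(isOpen_overlap p q).mem_nhds hy] with z hz
    rw [vectorDensity, coordDensity_eq_det_mul C.form hz, coordField_eq_inverse V hz,
      vectorDensity, map_smul, mul_smul]
  have hG := (C.contDiffAt_vectorDensity hV (transition_mem_target hy)).differentiableAt (by simp)
  have hdet : (A : Model n →L[ℝ] Model n).det ≠ 0 := A.toLinearEquiv.isUnit_det'.ne_zero
  have h1 : C.divergence V q = C.coordDivergence V q (extChartAt (𝓡 n) q q) := rfl
  rw [h1, coordDivergence, coordDivergence, hev.fderiv_eq,
    trace_fderiv_piola (contDiffAt_transition hy) A hA.symm hG, ← hτ,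
    coordDensity_eq_det_mul C.form hy, ← hA, mul_inv]
  field_simp

theorem continuous_divergence
    (hV : ContMDiff (𝓡 n) (𝓡 n).tangent ∞ (fun p => (⟨p, V p⟩ : TangentBundle (𝓡 n) M))) :
    Continuous (C.divergence V) := by
  rw [continuous_iff_continuousAt]
  intro p
  have hp := mem_extChartAt_target (I := 𝓡 n) p
  have h1 : ContinuousAt (C.coordDivergence V p) (extChartAt (𝓡 n) p p) := by
    have h2 := ((C.contDiffAt_vectorDensity hV hp).fderiv_right (m := 0) (by simp)).continuousAt
    have h3 : Continuous fun L : Model n →L[ℝ] Model n =>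
        LinearMap.trace ℝ (Model n) (L : Model n →ₗ[ℝ] Model n) :=
      (LinearMap.toContinuousLinearMap
        (LinearMap.trace ℝ (Model n) ∘ₗ ContinuousLinearMap.coeLM ℝ)).continuous
    exact ((C.contDiffAt_coordDensity hp).continuousAt.inv₀
      (coordDensity_ne_zero C.form_ne_zero hp)).mul (h3.continuousAt.comp h2)
  refine (h1.comp (continuousAt_extChartAt p)).congr ?_
  filter_upwards [extChartAt_source_mem_nhds (I := 𝓡 n) p] with q hq
  exact (C.divergence_eq_coordDivergence hV hq).symm

theorem mfderiv_apply_eq_fderiv {u : M → ℝ} {p q : M} (hq : q ∈ (extChartAt (𝓡 n) p).source)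
    (hu : MDifferentiableAt (𝓡 n) 𝓘(ℝ, ℝ) u q) :
    (mfderiv (𝓡 n) 𝓘(ℝ, ℝ) u q (V q) : ℝ) =
      fderiv ℝ (u ∘ (extChartAt (𝓡 n) p).symm) (extChartAt (𝓡 n) p q)
        (coordField V p (extChartAt (𝓡 n) p q)) := by
  have hy := (extChartAt (𝓡 n) p).map_source hq
  set y := extChartAt (𝓡 n) p q
  have hsy : (extChartAt (𝓡 n) p).symm y = q := (extChartAt (𝓡 n) p).left_inv hq
  obtain ⟨A, hA⟩ := isInvertible_chartFrame hy
  have h1 := (mdifferentiableAt_chart_symm hy).hasMFDerivAt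
  have h2 : HasMFDerivAt (𝓡 n) 𝓘(ℝ, ℝ) u ((extChartAt (𝓡 n) p).symm y)
      (mfderiv (𝓡 n) 𝓘(ℝ, ℝ) u ((extChartAt (𝓡 n) p).symm y)) := by
    rw [hsy]; exact hu.hasMFDerivAt
  have h3 := (h2.comp y h1).mfderiv
  rw [mfderiv_eq_fderiv] at h3
  rw [h3]
  have h4 : ∀ x x' : M, x = x' → ∀ v : Model n,
      (mfderiv (𝓡 n) 𝓘(ℝ, ℝ) u x v : ℝ) = mfderiv (𝓡 n) 𝓘(ℝ, ℝ) u x' v := by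
    rintro x _ rfl v; rfl
  have h5 : ∀ x x' : M, x = x' → (V x : Model n) = V x' := by
    rintro x _ rfl; rfl
  have h6 : chartFrame p y (coordField V p y) = V ((extChartAt (𝓡 n) p).symm y) := by
    have : coordField V p y = (chartFrame p y).inverse
      (V ((extChartAt (𝓡 n) p).symm y) : Model n) := rfl
    rw [this, ← hA, ContinuousLinearMap.inverse_equiv]
    exact A.apply_symm_apply _
  have h7 : (mfderiv (𝓡 n) 𝓘(ℝ, ℝ) u q (V q) : ℝ) =
      mfderiv (𝓡 n) 𝓘(ℝ, ℝ) u ((extChartAt (𝓡 n) p).symm y)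
        (V ((extChartAt (𝓡 n) p).symm y)) := by rw [hsy]
  exact h7.trans (congrArg (mfderiv (𝓡 n) 𝓘(ℝ, ℝ) u ((extChartAt (𝓡 n) p).symm y)) h6.symm)

theorem contDiffAt_comp_chart_symm {u : M → ℝ} {p : M} {y : Model n}
    (hy : y ∈ (extChartAt (𝓡 n) p).target)
    (hu : ContMDiffAt (𝓡 n) 𝓘(ℝ, ℝ) ∞ u ((extChartAt (𝓡 n) p).symm y)) :
    ContDiffAt ℝ ∞ (u ∘ (extChartAt (𝓡 n) p).symm) y :=
  (hu.comp y ((contMDiffOn_extChartAt_symm p).contMDiffAt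
    ((isOpen_extChartAt_target p).mem_nhds hy))).contDiffAt

/-- The derivative of a function along a vector field. -/
noncomputable def along (V : (p : M) → TangentSpace (𝓡 n) p) (u : M → ℝ) (p : M) : ℝ :=
  mfderiv (𝓡 n) 𝓘(ℝ, ℝ) u p (V p)

theorem continuous_along
    (hV : ContMDiff (𝓡 n) (𝓡 n).tangent ∞ (fun p => (⟨p, V p⟩ : TangentBundle (𝓡 n) M)))
    {u : M → ℝ} (hu : ContMDiff (𝓡 n) 𝓘(ℝ, ℝ) ∞ u) : Continuous (along V u) := by
  rw [continuous_iff_continuousAt]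
  intro p
  have hp := mem_extChartAt_target (I := 𝓡 n) p
  have h1 := ((contDiffAt_comp_chart_symm hp (hu _)).fderiv_right (m := 0) (by simp)).continuousAt
  have h2 := (contDiffAt_coordField hV hp).continuousAt
  refine ((h1.clm_apply h2).comp (continuousAt_extChartAt p)).congr ?_
  filter_upwards [extChartAt_source_mem_nhds (I := 𝓡 n) p] with q hq
  exact (mfderiv_apply_eq_fderiv hq ((hu q).mdifferentiableAt (by simp))).symm

theorem continuous_deriv (j : Fin m) {u : M → ℝ} (hu : ContMDiff (𝓡 n) 𝓘(ℝ, ℝ) ∞ u) :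
    Continuous (C.deriv j u) :=
  continuous_along (C.smooth_X j) hu

end CCSpace

end

end CC

/-! ### The measure of the volume form. -/

namespace CC

section

variable {n m : ℕ} {M : Type*} [TopologicalSpace M] [ChartedSpace (Model n) M]
  [IsManifold (𝓡 n) ∞ M] [MeasurableSpace M] [BorelSpace M]

theorem measurableSet_target_inter_preimage (p : M) {s : Set M} (hs : MeasurableSet s) :
    MeasurableSet ((extChartAt (𝓡 n) p).target ∩ (extChartAt (𝓡 n) p).symm ⁻¹' s) := by
  have h := (continuousOn_iff_continuous_domRestrict.1
    (continuousOn_extChartAt_symm (I := 𝓡 n) p)).measurable hs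
  have h2 := (isOpen_extChartAt_target (I := 𝓡 n) p).measurableSet.subtype_image h
  convert h2 using 1
  ext y
  simp [and_comm]

namespace CCSpace

variable (C : CCSpace n m M)

theorem aemeasurable_coordDensity (p : M) :
    AEMeasurable (coordDensity C.form p) (volume.restrict (extChartAt (𝓡 n) p).target) :=
  ((C.smooth_form p).continuousOn).aemeasurable (isOpen_extChartAt_target p).measurableSet

theorem aemeasurable_chart_symm (p : M) :
    AEMeasurable (extChartAt (𝓡 n) p).symm (volume.restrict (extChartAt (𝓡 n) p).target) :=
  (continuousOn_extChartAt_symm p).aemeasurable (isOpen_extChartAt_target p).measurableSet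

theorem aemeasurable_chart_symm_withDensity (p : M) (f : Model n → ℝ≥0∞) :
    AEMeasurable (extChartAt (𝓡 n) p).symm
      ((volume.restrict (extChartAt (𝓡 n) p).target).withDensity f) :=
  (aemeasurable_chart_symm p).mono_ac (withDensity_absolutelyContinuous _ _)

theorem chartMeasure_apply (p : M) {s : Set M} (hs : MeasurableSet s) :
    C.chartMeasure p s = ∫⁻ y in (extChartAt (𝓡 n) p).target ∩ (extChartAt (𝓡 n) p).symm ⁻¹' s,
      ENNReal.ofReal |coordDensity C.form p y| := by
  rw [chartMeasure, Measure.map_apply_of_aemeasurable (aemeasurable_chart_symm_withDensity p _) hs,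
    withDensity_apply', Measure.restrict_restrict' (isOpen_extChartAt_target p).measurableSet,
    inter_comm]

theorem chartMeasure_compl_source (p : M) :
    C.chartMeasure p (extChartAt (𝓡 n) p).sourceᶜ = 0 := by
  rw [chartMeasure_apply C p (isOpen_extChartAt_source p).measurableSet.compl]
  have : (extChartAt (𝓡 n) p).target ∩ (extChartAt (𝓡 n) p).symm ⁻¹'
      (extChartAt (𝓡 n) p).sourceᶜ = ∅ :=
    eq_empty_of_forall_notMem fun y hy => hy.2 ((extChartAt (𝓡 n) p).map_target hy.1)
  rw [this, Measure.restrict_empty, lintegral_zero_measure]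

/-- In the change of variables formula for the transition map, the factor `|det|` is exactly the one
by which the two densities differ. -/
theorem chartMeasure_eq_of_subset {p q : M} {s : Set M} (hs : MeasurableSet s)
    (hsp : s ⊆ (extChartAt (𝓡 n) p).source) (hsq : s ⊆ (extChartAt (𝓡 n) q).source) :
    C.chartMeasure p s = C.chartMeasure q s := by
  rw [chartMeasure_apply C p hs, chartMeasure_apply C q hs]
  set D := (extChartAt (𝓡 n) p).target ∩ (extChartAt (𝓡 n) p).symm ⁻¹' s with hD_def
  have hD : D ⊆ overlap n p q := fun y hy => ⟨hy.1, hsq hy.2⟩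
  have himage : (extChartAt (𝓡 n) q).target ∩ (extChartAt (𝓡 n) q).symm ⁻¹' s =
      transition n p q '' D := by
    ext z
    constructor
    · rintro ⟨hz, hzs⟩
      have hzo : z ∈ overlap n q p := ⟨hz, hsp hzs⟩
      refine ⟨transition n q p z, ⟨transition_mem_target hzo, ?_⟩, transition_transition hzo⟩
      rw [mem_preimage, symm_transition hzo]; exact hzs
    · rintro ⟨y, hy, rfl⟩
      refine ⟨transition_mem_target (hD hy), ?_⟩
      rw [mem_preimage, symm_transition (hD hy)]; exact hy.2
  have hinj : InjOn (transition n p q) D := fun y hy z hz h => by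
    rw [← transition_transition (hD hy), h, transition_transition (hD hz)]
  rw [himage, lintegral_image_eq_lintegral_abs_det_fderiv_mul volume
    (measurableSet_target_inter_preimage p hs)
    (fun y hy => ((contDiffAt_transition (hD hy)).differentiableAt
      (by simp)).hasFDerivAt.hasFDerivWithinAt) hinj]
  refine setLIntegral_congr_fun (measurableSet_target_inter_preimage p hs) fun y hy => ?_
  rw [coordDensity_eq_det_mul C.form (hD hy), abs_mul, ENNReal.ofReal_mul (abs_nonneg _)]

variable [SigmaCompactSpace M]

/-- A supremum of measures is hard to evaluate directly. A countable Borel partition subordinate to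
chart domains glues the chart measures to a measure `ν` that dominates all of them, hence `vol`. On
a chart domain `ν` is the chart measure, since chart measures agree on overlaps. -/
theorem vol_apply_of_subset_source {p : M} {s : Set M} (hs : MeasurableSet s)
    (hsp : s ⊆ (extChartAt (𝓡 n) p).source) : C.vol s = C.chartMeasure p s := by
  have : SecondCountableTopology M := ChartedSpace.secondCountable_of_sigmaCompact (Model n) M
  have : Nonempty M := ⟨p⟩
  obtain ⟨t, htc, htU⟩ := TopologicalSpace.countable_cover_nhds
    (fun q : M => extChartAt_source_mem_nhds (I := 𝓡 n) q)
  have hne : t.Nonempty := by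
    by_contra h
    rw [not_nonempty_iff_eq_empty] at h
    rw [h, biUnion_empty] at htU
    exact empty_ne_univ htU
  obtain ⟨f, rfl⟩ := htc.exists_eq_range hne
  let B : ℕ → Set M := disjointed fun i => (extChartAt (𝓡 n) (f i)).source
  have hBsub : ∀ i, B i ⊆ (extChartAt (𝓡 n) (f i)).source := fun i => disjointed_subset _ i
  have hBm : ∀ i, MeasurableSet (B i) := fun i =>
    MeasurableSet.disjointed (fun i => (isOpen_extChartAt_source (f i)).measurableSet) i
  have hBU : ⋃ i, B i = univ := by
    rw [iUnion_disjointed, ← htU, biUnion_range]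
  have hBd : Pairwise (Function.onFun Disjoint B) := disjoint_disjointed _
  have hsum : ∀ (μ : Measure M) (E : Set M), MeasurableSet E → μ E = ∑' i, μ (E ∩ B i) := by
    intro μ E hE
    rw [← measure_iUnion (fun i j hij => (hBd hij).mono inter_subset_right inter_subset_right)
      (fun i => hE.inter (hBm i)), ← inter_iUnion, hBU, inter_univ]
  have hle : ∀ q E, MeasurableSet E →
      C.chartMeasure q E ≤ ∑' i, C.chartMeasure (f i) (E ∩ B i) := by
    intro q E hE
    rw [hsum _ E hE]
    refine ENNReal.tsum_le_tsum fun i => ?_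
    have hS := (isOpen_extChartAt_source (I := 𝓡 n) q).measurableSet
    calc C.chartMeasure q (E ∩ B i)
        ≤ C.chartMeasure q (E ∩ B i ∩ (extChartAt (𝓡 n) q).source) +
          C.chartMeasure q (extChartAt (𝓡 n) q).sourceᶜ := by
          refine (measure_mono ?_).trans (measure_union_le _ _)
          intro x hx
          by_cases h : x ∈ (extChartAt (𝓡 n) q).source
          · exact Or.inl ⟨hx, h⟩
          · exact Or.inr h
      _ = C.chartMeasure (f i) (E ∩ B i ∩ (extChartAt (𝓡 n) q).source) := by
          rw [chartMeasure_compl_source, add_zero]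
          exact C.chartMeasure_eq_of_subset ((hE.inter (hBm i)).inter hS) inter_subset_right
            (fun x hx => hBsub i hx.1.2)
      _ ≤ _ := measure_mono inter_subset_left
  let ν : Measure M := Measure.sum fun i => (C.chartMeasure (f i)).restrict (B i)
  have hν : ∀ E, MeasurableSet E → ν E = ∑' i, C.chartMeasure (f i) (E ∩ B i) := fun E hE => by
    rw [Measure.sum_apply _ hE]
    exact tsum_congr fun i => Measure.restrict_apply hE
  have hvol : C.vol ≤ ν := iSup_le fun q => Measure.le_iff.2 fun E hE => by
    rw [hν E hE]; exact hle q E hE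
  refine le_antisymm ((hvol s).trans ?_) (le_iSup C.chartMeasure p s)
  rw [hν s hs, hsum (C.chartMeasure p) s hs]
  refine ENNReal.tsum_le_tsum fun i => le_of_eq ?_
  exact C.chartMeasure_eq_of_subset (hs.inter (hBm i)) (fun x hx => hBsub i hx.2)
    (fun x hx => hsp hx.1)

theorem vol_restrict_source (p : M) :
    C.vol.restrict (extChartAt (𝓡 n) p).source = C.chartMeasure p := by
  have hS := (isOpen_extChartAt_source (I := 𝓡 n) p).measurableSet
  ext s hs
  rw [Measure.restrict_apply hs, C.vol_apply_of_subset_source (hs.inter hS) inter_subset_right]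
  refine le_antisymm (measure_mono inter_subset_left) ?_
  calc C.chartMeasure p s ≤ C.chartMeasure p (s ∩ (extChartAt (𝓡 n) p).source) +
        C.chartMeasure p (extChartAt (𝓡 n) p).sourceᶜ := by
        refine (measure_mono ?_).trans (measure_union_le _ _)
        intro x hx
        by_cases h : x ∈ (extChartAt (𝓡 n) p).source
        · exact Or.inl ⟨hx, h⟩
        · exact Or.inr h
    _ = _ := by rw [chartMeasure_compl_source, add_zero]

theorem integral_vol_eq_of_support_subset {p : M} {f : M → ℝ} (hf : Continuous f)
    (hsupp : Function.support f ⊆ (extChartAt (𝓡 n) p).source) :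
    ∫ x, f x ∂C.vol = ∫ y in (extChartAt (𝓡 n) p).target,
      |coordDensity C.form p y| * f ((extChartAt (𝓡 n) p).symm y) := by
  rw [← setIntegral_eq_integral_of_forall_compl_eq_zero
    (fun x hx => Function.notMem_support.1 fun h => hx (hsupp h)), C.vol_restrict_source,
    chartMeasure, integral_map (aemeasurable_chart_symm_withDensity p _)
      hf.measurable.aestronglyMeasurable,
    integral_withDensity_eq_integral_toReal_smul₀
      (C.aemeasurable_coordDensity p).abs.ennreal_ofReal (by simp)]
  refine integral_congr_ae (Eventually.of_forall fun y => ?_)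
  simp [ENNReal.toReal_ofReal (abs_nonneg _)]

/-- On a small coordinate ball the density is bounded. This makes continuous functions with compact
support integrable. -/
theorem isLocallyFiniteMeasure_vol : IsLocallyFiniteMeasure C.vol := by
  refine ⟨fun p => ?_⟩
  have hp := mem_extChartAt_target (I := 𝓡 n) p
  set y₀ := extChartAt (𝓡 n) p p
  have hcont := (C.contDiffAt_coordDensity hp).continuousAt.abs
  have hev : ∀ᶠ y in 𝓝 y₀, |coordDensity C.form p y| < |coordDensity C.form p y₀| + 1 :=
    hcont.eventually_lt_const (lt_add_one _)
  obtain ⟨R, hR, hball⟩ := Metric.eventually_nhds_iff_ball.1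
    (hev.and ((isOpen_extChartAt_target (I := 𝓡 n) p).mem_nhds hp))
  set s : Set M := (extChartAt (𝓡 n) p).source ∩ extChartAt (𝓡 n) p ⁻¹' Metric.ball y₀ R
  have hs : IsOpen s := (continuousOn_extChartAt p).isOpen_inter_preimage
    (isOpen_extChartAt_source p) Metric.isOpen_ball
  refine ⟨s, hs.mem_nhds ⟨mem_extChartAt_source p, Metric.mem_ball_self hR⟩, ?_⟩
  rw [C.vol_apply_of_subset_source hs.measurableSet inter_subset_left,
    chartMeasure_apply C p hs.measurableSet]
  have hsub : (extChartAt (𝓡 n) p).target ∩ (extChartAt (𝓡 n) p).symm ⁻¹' s ⊆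
      Metric.ball y₀ R := fun y hy => by
    have := hy.2.2
    rwa [mem_preimage, (extChartAt (𝓡 n) p).right_inv hy.1] at this
  refine (lintegral_mono_set hsub).trans_lt ?_
  refine (setLIntegral_mono' (g := fun _ => ENNReal.ofReal (|coordDensity C.form p y₀| + 1))
    Metric.isOpen_ball.measurableSet
    (fun y hy => ENNReal.ofReal_le_ofReal (hball y hy).1.le)).trans_lt ?_
  rw [setLIntegral_const]
  exact ENNReal.mul_lt_top ENNReal.ofReal_lt_top measure_ball_lt_top

end CCSpace

end

end CC

/-! ### The divergence theorem in Euclidean space and in one chart. -/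

/-- The divergence theorem for compactly supported vector fields. -/
theorem integral_trace_fderiv_eq_zero {ι : Type*} [Fintype ι]
    {F : EuclideanSpace ℝ ι → EuclideanSpace ℝ ι} (hF : ContDiff ℝ 1 F) (hc : HasCompactSupport F) :
    ∫ y, LinearMap.trace ℝ (EuclideanSpace ℝ ι)
      (fderiv ℝ F y : EuclideanSpace ℝ ι →ₗ[ℝ] EuclideanSpace ℝ ι) = 0 := by
  let b := (EuclideanSpace.basisFun ι ℝ).toBasis
  let π : ι → EuclideanSpace ℝ ι →L[ℝ] ℝ := fun i => EuclideanSpace.proj i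
  have htr : ∀ y, LinearMap.trace ℝ (EuclideanSpace ℝ ι)
      (fderiv ℝ F y : EuclideanSpace ℝ ι →ₗ[ℝ] EuclideanSpace ℝ ι) =
      ∑ i, fderiv ℝ (fun z => π i (F z)) y (b i) := by
    intro y
    classical
    rw [LinearMap.trace_eq_matrix_trace ℝ b, Matrix.trace]
    refine Finset.sum_congr rfl fun i _ => ?_
    have h1 := ((π i).hasFDerivAt.comp y (hF.differentiable one_ne_zero y).hasFDerivAt).fderiv
    have h2 : fderiv ℝ (fun z => π i (F z)) y = (π i) ∘L fderiv ℝ F y := h1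
    rw [h2, Matrix.diag_apply, LinearMap.toMatrix_apply]
    simp [b, π]
  have hcs : ∀ i, ContDiff ℝ 1 fun z => π i (F z) := fun i => (π i).contDiff.comp hF
  have hcc : ∀ i, HasCompactSupport fun z => π i (F z) := fun i =>
    hc.comp_left (g := π i) (map_zero _)
  have hfc : ∀ i, Continuous fun y => fderiv ℝ (fun z => π i (F z)) y (b i) := fun i =>
    ((hcs i).continuous_fderiv one_ne_zero).clm_apply continuous_const
  have hfcc : ∀ i, HasCompactSupport fun y => fderiv ℝ (fun z => π i (F z)) y (b i) := fun i =>
    ((hcc i).fderiv (𝕜 := ℝ)).comp_left (g := fun L : EuclideanSpace ℝ ι →L[ℝ] ℝ => L (b i)) rfl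
  have hint : ∀ i, Integrable fun y => fderiv ℝ (fun z => π i (F z)) y (b i) := fun i =>
    (hfc i).integrable_of_hasCompactSupport (hfcc i)
  simp_rw [htr]
  rw [integral_finsetSum _ fun i _ => hint i]
  refine Finset.sum_eq_zero fun i _ => ?_
  -- Integration by parts against the constant function `1` shows that the integral of a partial
  -- derivative vanishes.
  have h := integral_mul_fderiv_eq_neg_fderiv_mul_of_integrable (μ := volume)
    (f := fun _ : EuclideanSpace ℝ ι => (1 : ℝ)) (g := fun z => π i (F z)) (v := b i)
    (by simp) (by simpa using hint i)
    (by simpa using (hcs i).continuous.integrable_of_hasCompactSupport (hcc i))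
    (fun _ _ => differentiableAt_const _)
    (fun x _ => (hcs i).differentiable one_ne_zero x)
  simpa using h

namespace CC

section

variable {n m : ℕ} {M : Type*} [TopologicalSpace M] [ChartedSpace (Model n) M]
  [IsManifold (𝓡 n) ∞ M] [MeasurableSpace M] [BorelSpace M]

namespace CCSpace

variable (C : CCSpace n m M)

variable [SigmaCompactSpace M] {V : (p : M) → TangentSpace (𝓡 n) p}

theorem trace_fderiv_smul {F : Model n → Model n} {g : Model n → ℝ} {y : Model n}
    (hg : DifferentiableAt ℝ g y) (hF : DifferentiableAt ℝ F y) :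
    LinearMap.trace ℝ (Model n) (fderiv ℝ (fun z => g z • F z) y : Model n →ₗ[ℝ] Model n) =
      fderiv ℝ g y (F y) +
        g y * LinearMap.trace ℝ (Model n) (fderiv ℝ F y : Model n →ₗ[ℝ] Model n) := by
  have h1 : (fderiv ℝ (fun z => g z • F z) y : Model n →ₗ[ℝ] Model n) =
      g y • (fderiv ℝ F y : Model n →ₗ[ℝ] Model n) +
        (fderiv ℝ g y : Model n →ₗ[ℝ] ℝ).smulRight (F y) := by
    have h2 : fderiv ℝ (fun z => g z • F z) y = _ := (hg.hasFDerivAt.smul hF.hasFDerivAt).fderiv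
    rw [h2]; rfl
  rw [h1, map_add, map_smul, LinearMap.trace_smulRight, add_comm]
  rfl

/-- With `ρ` the density, the integrand times `|ρ|` is in coordinates the Euclidean divergence of
the field `ψ |ρ| V`, which has compact support. -/
theorem integral_along_add_divergence_mul_of_chart [T2Space M]
    (hV : ContMDiff (𝓡 n) (𝓡 n).tangent ∞ (fun p => (⟨p, V p⟩ : TangentBundle (𝓡 n) M)))
    {ψ : M → ℝ} (hψ : ContMDiff (𝓡 n) 𝓘(ℝ, ℝ) ∞ ψ) (hc : HasCompactSupport ψ)
    {p : M} (hp : tsupport ψ ⊆ (extChartAt (𝓡 n) p).source) :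
    ∫ x, (along V ψ x + C.divergence V x * ψ x) ∂C.vol = 0 := by
  set e := extChartAt (𝓡 n) p
  have hto : IsOpen e.target := isOpen_extChartAt_target p
  have hsub : Function.support (fun x => along V ψ x + C.divergence V x * ψ x) ⊆ tsupport ψ := by
    intro x hx
    by_contra h
    refine hx ?_
    have h0 : ψ =ᶠ[𝓝 x] fun _ => 0 := notMem_tsupport_iff_eventuallyEq.1 h
    have h1 : along V ψ x = 0 := by
      rw [along, h0.mfderiv_eq, mfderiv_const]; rfl
    simp [h1, h0.eq_of_nhds]
  have hcont : Continuous fun x => along V ψ x + C.divergence V x * ψ x :=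
    (continuous_along hV hψ).add ((C.continuous_divergence hV).mul hψ.continuous)
  rw [C.integral_vol_eq_of_support_subset hcont (hsub.trans hp)]
  let g : Model n → ℝ := ψ ∘ e.symm
  let K : Set (Model n) := e '' tsupport ψ
  have hK : IsCompact K := hc.isCompact.image_of_continuousOn
    ((continuousOn_extChartAt p).mono hp)
  have hKt : K ⊆ e.target := by
    rintro _ ⟨x, hx, rfl⟩; exact e.map_source (hp hx)
  have hgK : ∀ y ∈ e.target, y ∉ K → g y = 0 := fun y hy hyK => by
    by_contra h
    exact hyK ⟨e.symm y, subset_tsupport _ h, e.right_inv hy⟩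
  -- The absolute value comes from the measure; it is smooth where it is used because `ρ` does not
  -- vanish. Extension by zero is `C¹` because the support lies in the compact set `K` inside the
  -- open chart target.
  let F : Model n → Model n := e.target.indicator fun y =>
    (g y * |coordDensity C.form p y|) • coordField V p y
  have hFsupp : Function.support F ⊆ K := by
    intro y hy
    by_contra h
    refine hy ?_
    by_cases hyt : y ∈ e.target
    · simp [F, hyt, hgK y hyt h]
    · simp [F, hyt]
  have hgs : ∀ y ∈ e.target, ContDiffAt ℝ ∞ g y := fun y hy =>
    contDiffAt_comp_chart_symm hy (hψ _)
  have hFs : ContDiff ℝ 1 F := by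
    rw [contDiff_iff_contDiffAt]
    intro y
    by_cases hyt : y ∈ e.target
    · have h1 : ContDiffAt ℝ 1 (fun y => (g y * |coordDensity C.form p y|) • coordField V p y) y :=
        ((((hgs y hyt).mul ((contDiffAt_abs (coordDensity_ne_zero C.form_ne_zero hyt)).comp y
          (C.contDiffAt_coordDensity hyt))).smul (contDiffAt_coordField hV hyt)).of_le (by simp))
      refine h1.congr_of_eventuallyEq ?_
      filter_upwards [hto.mem_nhds hyt] with z hz
      exact indicator_of_mem hz _
    · have h1 : F =ᶠ[𝓝 y] fun _ => 0 := by
        filter_upwards [hK.isClosed.isOpen_compl.mem_nhds fun h => hyt (hKt h)] with z hz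
        by_contra h
        exact hz (hFsupp h)
      exact contDiffAt_const.congr_of_eventuallyEq h1
  have hFc : HasCompactSupport F := HasCompactSupport.intro hK fun y hy => by
    by_contra h
    exact hy (hFsupp h)
  rw [← integral_trace_fderiv_eq_zero hFs hFc]
  have hsetint := setIntegral_eq_integral_of_forall_compl_eq_zero (μ := volume) (s := e.target)
    (f := fun y => LinearMap.trace ℝ (Model n) (fderiv ℝ F y : Model n →ₗ[ℝ] Model n)) (by
      intro y hy
      have h1 : F =ᶠ[𝓝 y] fun _ => 0 := by
        filter_upwards [hK.isClosed.isOpen_compl.mem_nhds fun h => hy (hKt h)] with z hz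
        by_contra h
        exact hz (hFsupp h)
      rw [h1.fderiv_eq]
      simp)
  rw [← hsetint]
  refine setIntegral_congr_fun hto.measurableSet fun y hy => ?_
  have hys : e.symm y ∈ e.source := e.map_target hy
  have hr : e (e.symm y) = y := e.right_inv hy
  have h1 : along V ψ (e.symm y) = fderiv ℝ g y (coordField V p y) := by
    have := mfderiv_apply_eq_fderiv (V := V) hys ((hψ (e.symm y)).mdifferentiableAt (by simp))
    rw [along, this, hr]
  have h2 : C.divergence V (e.symm y) = C.coordDivergence V p y := by
    rw [C.divergence_eq_coordDivergence hV hys, hr]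
  have hρ := coordDensity_ne_zero C.form_ne_zero hy
  have hρc := (C.contDiffAt_coordDensity hy).continuousAt
  -- Near `y` the density has constant sign `s = ±1`, so `|ρ| = s ρ` there and `F` becomes a
  -- multiple of the vector density.
  obtain ⟨s, hs, hsρ⟩ : ∃ s : ℝ, s * coordDensity C.form p y = |coordDensity C.form p y| ∧
      F =ᶠ[𝓝 y] fun z => s • (g z • C.vectorDensity V p z) := by
    rcases hρ.lt_or_gt with h | h
    · refine ⟨-1, by rw [abs_of_neg h]; ring, ?_⟩
      filter_upwards [hto.mem_nhds hy, hρc.eventually_lt_const h] with z hz hz2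
      simp [F, hz, abs_of_neg hz2, vectorDensity, smul_smul]
    · refine ⟨1, by rw [abs_of_pos h]; ring, ?_⟩
      filter_upwards [hto.mem_nhds hy, hρc.eventually_const_lt h] with z hz hz2
      simp [F, hz, abs_of_pos hz2, vectorDensity, smul_smul]
  have hgd := (hgs y hy).differentiableAt (by simp)
  have hvd := (C.contDiffAt_vectorDensity hV hy).differentiableAt (by simp)
  have h3 : fderiv ℝ F y = s • fderiv ℝ (fun z => g z • C.vectorDensity V p z) y := by
    rw [hsρ.fderiv_eq]
    exact fderiv_const_smul (hgd.smul hvd) s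
  have h4 : LinearMap.trace ℝ (Model n) (fderiv ℝ F y : Model n →ₗ[ℝ] Model n) =
      s * (fderiv ℝ g y (C.vectorDensity V p y) + g y *
        LinearMap.trace ℝ (Model n) (fderiv ℝ (C.vectorDensity V p) y : Model n →ₗ[ℝ] Model n)) := by
    rw [← trace_fderiv_smul hgd hvd, h3]
    exact map_smul (LinearMap.trace ℝ (Model n)) s _
  beta_reduce
  rw [h4, h1, h2, ← hs, coordDivergence]
  have h5 : C.vectorDensity V p y = coordDensity C.form p y • coordField V p y := rfl
  rw [h5, map_smul, smul_eq_mul]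
  have h6 : ψ (e.symm y) = g y := rfl
  rw [h6]
  field_simp

end CCSpace

end

end CC

/-! ### Global integration by parts and the perimeter of superlevel sets. -/

namespace CC

section

variable {n m : ℕ} {M : Type*} [TopologicalSpace M] [ChartedSpace (Model n) M]
  [IsManifold (𝓡 n) ∞ M]

theorem CCSpace.along_add {V : (p : M) → TangentSpace (𝓡 n) p} {u v : M → ℝ} {x : M}
    (hu : MDifferentiableAt (𝓡 n) 𝓘(ℝ, ℝ) u x) (hv : MDifferentiableAt (𝓡 n) 𝓘(ℝ, ℝ) v x) :
    CCSpace.along V (u + v) x = CCSpace.along V u x + CCSpace.along V v x := by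
  rw [CCSpace.along, (hu.hasMFDerivAt.add hv.hasMFDerivAt).mfderiv]
  rfl

theorem CCSpace.along_mul {V : (p : M) → TangentSpace (𝓡 n) p} {u v : M → ℝ} {x : M}
    (hu : MDifferentiableAt (𝓡 n) 𝓘(ℝ, ℝ) u x) (hv : MDifferentiableAt (𝓡 n) 𝓘(ℝ, ℝ) v x) :
    CCSpace.along V (u * v) x = u x * CCSpace.along V v x + v x * CCSpace.along V u x := by
  rw [CCSpace.along, (hu.hasMFDerivAt.mul hv.hasMFDerivAt).mfderiv]
  rfl

theorem CCSpace.along_comp {V : (p : M) → TangentSpace (𝓡 n) p} {u : M → ℝ} {η : ℝ → ℝ} {x : M}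
    (hη : DifferentiableAt ℝ η (u x)) (hu : MDifferentiableAt (𝓡 n) 𝓘(ℝ, ℝ) u x) :
    CCSpace.along V (η ∘ u) x = _root_.deriv η (u x) * CCSpace.along V u x := by
  rw [CCSpace.along, (hη.hasDerivAt.hasFDerivAt.hasMFDerivAt.comp x hu.hasMFDerivAt).mfderiv,
    mul_comm]
  rfl

theorem CCSpace.along_eq_zero {V : (p : M) → TangentSpace (𝓡 n) p} {u : M → ℝ} {x : M}
    (hx : x ∉ tsupport u) : CCSpace.along V u x = 0 := by
  rw [CCSpace.along, (notMem_tsupport_iff_eventuallyEq.1 hx).mfderiv_eq]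
  exact DFunLike.congr_fun (mfderiv_const (I := 𝓡 n) (I' := 𝓘(ℝ, ℝ)) (c := (0 : ℝ))) (V x)

variable [MeasurableSpace M] [BorelSpace M] [SigmaCompactSpace M] [T2Space M]

namespace CCSpace

variable (C : CCSpace n m M)

theorem integrable_of_hasCompactSupport {f : M → ℝ} (hf : Continuous f)
    (hc : HasCompactSupport f) : Integrable f C.vol := by
  have := C.isLocallyFiniteMeasure_vol
  exact hf.integrable_of_hasCompactSupport hc

/-- A partition of unity subordinate to the chart domains writes `ψ` as a finite sum of functions
supported in single charts, since only finitely many members meet the compact support. -/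
theorem integral_along_add_divergence_mul {V : (p : M) → TangentSpace (𝓡 n) p}
    (hV : ContMDiff (𝓡 n) (𝓡 n).tangent ∞ (fun p => (⟨p, V p⟩ : TangentBundle (𝓡 n) M)))
    {ψ : M → ℝ} (hψ : ContMDiff (𝓡 n) 𝓘(ℝ, ℝ) ∞ ψ) (hc : HasCompactSupport ψ) :
    ∫ x, (along V ψ x + C.divergence V x * ψ x) ∂C.vol = 0 := by
  obtain ⟨f, hf⟩ := SmoothPartitionOfUnity.exists_isSubordinate (𝓡 n) (isClosed_tsupport ψ)
    (fun p : M => (extChartAt (𝓡 n) p).source) (fun p => isOpen_extChartAt_source p)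
    (fun x _ => mem_iUnion.2 ⟨x, mem_extChartAt_source x⟩)
  have hfin := f.locallyFinite.finite_nonempty_inter_compact hc.isCompact
  have hg : ∀ i, ContMDiff (𝓡 n) 𝓘(ℝ, ℝ) ∞ (f i * ψ : M → ℝ) := fun i =>
    (f i).contMDiff.mul hψ
  have hsum : ψ = ∑ i ∈ hfin.toFinset, (f i * ψ : M → ℝ) := by
    ext x
    rw [Finset.sum_apply]
    by_cases hx : x ∈ tsupport ψ
    · have h1 : ∑ᶠ i, f i x = ∑ i ∈ hfin.toFinset, f i x :=
        finsum_eq_sum_of_support_subset _ fun i hi => by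
          simpa using ⟨x, hi, hx⟩
      simp only [Pi.mul_apply]
      rw [← Finset.sum_mul, ← h1, f.sum_eq_one hx, one_mul]
    · simp [image_eq_zero_of_notMem_tsupport hx]
  have key : ∀ s : Finset M, ContMDiff (𝓡 n) 𝓘(ℝ, ℝ) ∞ (∑ i ∈ s, (f i * ψ : M → ℝ)) ∧
      HasCompactSupport (∑ i ∈ s, (f i * ψ : M → ℝ)) ∧
      ∫ x, (along V (∑ i ∈ s, (f i * ψ : M → ℝ)) x +
        C.divergence V x * (∑ i ∈ s, (f i * ψ : M → ℝ)) x) ∂C.vol = 0 := by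
    intro s
    classical
    induction s using Finset.induction_on with
    | empty =>
      have h0 : ∀ x, along V (0 : M → ℝ) x = 0 := fun x => along_eq_zero (by simp)
      refine ⟨contMDiff_const, HasCompactSupport.zero, ?_⟩
      simp [h0]
    | insert i s his ih =>
      obtain ⟨h1, h2, h3⟩ := ih
      have hci : HasCompactSupport (f i * ψ : M → ℝ) := hc.mul_left
      have hi := C.integral_along_add_divergence_mul_of_chart hV (hg i) hci (p := i)
        ((tsupport_mul_subset_left (f := f i) (g := ψ)).trans (hf i))
      rw [Finset.sum_insert his]
      refine ⟨(hg i).add h1, hci.add h2, ?_⟩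
      have hint : ∀ u : M → ℝ, ContMDiff (𝓡 n) 𝓘(ℝ, ℝ) ∞ u → HasCompactSupport u →
          Integrable (fun x => along V u x + C.divergence V x * u x) C.vol := fun u hu huc =>
        C.integrable_of_hasCompactSupport
          ((continuous_along hV hu).add ((C.continuous_divergence hV).mul hu.continuous))
          (HasCompactSupport.intro huc.isCompact fun x hx => by
            rw [along_eq_zero hx, image_eq_zero_of_notMem_tsupport hx]; simp)
      have := integral_add (hint _ (hg i) hci) (hint _ h1 h2)
      rw [hi, h3, add_zero] at this
      rw [← this]
      refine integral_congr_ae (Eventually.of_forall fun x => ?_)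
      beta_reduce
      rw [along_add ((hg i x).mdifferentiableAt (by simp)) ((h1 x).mdifferentiableAt (by simp)),
        Pi.add_apply]
      ring
  have := (key hfin.toFinset).2.2
  rwa [← hsum] at this

theorem continuous_formalAdjoint (j : Fin m) {φ : M → ℝ} (hφ : ContMDiff (𝓡 n) 𝓘(ℝ, ℝ) ∞ φ) :
    Continuous (C.formalAdjoint j φ) :=
  (C.continuous_deriv j hφ).neg.sub ((C.continuous_divergence (C.smooth_X j)).mul hφ.continuous)

theorem deriv_eq_zero (j : Fin m) {φ : M → ℝ} {x : M} (hx : x ∉ tsupport φ) :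
    C.deriv j φ x = 0 := along_eq_zero (V := C.X j) hx

theorem formalAdjoint_eq_zero (j : Fin m) {φ : M → ℝ} {x : M} (hx : x ∉ tsupport φ) :
    C.formalAdjoint j φ x = 0 := by
  rw [formalAdjoint, deriv_eq_zero C j hx, image_eq_zero_of_notMem_tsupport hx]
  simp

theorem hasCompactSupport_formalAdjoint (j : Fin m) {φ : M → ℝ} (hc : HasCompactSupport φ) :
    HasCompactSupport (C.formalAdjoint j φ) :=
  HasCompactSupport.intro hc.isCompact fun _ hx => C.formalAdjoint_eq_zero j hx

theorem hasCompactSupport_deriv (j : Fin m) {φ : M → ℝ} (hc : HasCompactSupport φ) :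
    HasCompactSupport (C.deriv j φ) :=
  HasCompactSupport.intro hc.isCompact fun _ hx => C.deriv_eq_zero j hx

/-- Integration by parts. -/
theorem integral_mul_formalAdjoint (j : Fin m) {g φ : M → ℝ}
    (hg : ContMDiff (𝓡 n) 𝓘(ℝ, ℝ) ∞ g) (hφ : ContMDiff (𝓡 n) 𝓘(ℝ, ℝ) ∞ φ)
    (hc : HasCompactSupport φ) :
    ∫ x, g x * C.formalAdjoint j φ x ∂C.vol = ∫ x, C.deriv j g x * φ x ∂C.vol := by
  have h := C.integral_along_add_divergence_mul (C.smooth_X j) (hg.mul hφ) hc.mul_left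
  have h1 : Integrable (fun x => g x * C.formalAdjoint j φ x) C.vol :=
    C.integrable_of_hasCompactSupport (hg.continuous.mul (C.continuous_formalAdjoint j hφ))
      (C.hasCompactSupport_formalAdjoint j hc).mul_left
  have h2 : Integrable (fun x => C.deriv j g x * φ x) C.vol :=
    C.integrable_of_hasCompactSupport ((C.continuous_deriv j hg).mul hφ.continuous) hc.mul_left
  rw [eq_comm, ← sub_eq_zero, ← integral_sub h2 h1, ← h]
  refine integral_congr_ae (Eventually.of_forall fun x => ?_)
  beta_reduce
  have h3 := along_mul (V := C.X j) ((hg x).mdifferentiableAt (by simp))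
    ((hφ x).mdifferentiableAt (by simp))
  rw [h3, formalAdjoint]
  change _ = g x * C.deriv j φ x + φ x * C.deriv j g x + C.divergence (C.X j) x * (g x * φ x)
  ring

/-- The length of the horizontal gradient. -/
noncomputable def gradNorm (u : M → ℝ) (x : M) : ℝ := √(∑ j, C.deriv j u x ^ 2)

theorem continuous_gradNorm {u : M → ℝ} (hu : ContMDiff (𝓡 n) 𝓘(ℝ, ℝ) ∞ u) :
    Continuous (C.gradNorm u) :=
  (continuous_finsetSum _ fun j _ => (C.continuous_deriv j hu).pow 2).sqrt

/-- The smooth approximations of the indicator function of `(t, ∞)`. -/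
noncomputable def smoothStep (k : ℕ) (t s : ℝ) : ℝ := Real.smoothTransition ((k + 1) * (s - t))

theorem contDiff_smoothStep (k : ℕ) (t : ℝ) : ContDiff ℝ ∞ (smoothStep k t) :=
  Real.smoothTransition.contDiff.comp (by fun_prop)

theorem deriv_smoothStep (k : ℕ) (t s : ℝ) : _root_.deriv (smoothStep k t) s =
    (k + 1) * _root_.deriv Real.smoothTransition ((k + 1) * (s - t)) := by
  have h1 : HasDerivAt (fun s : ℝ => (k + 1 : ℝ) * (s - t)) (k + 1) s := by
    simpa using ((hasDerivAt_id s).sub_const t).const_mul (k + 1 : ℝ)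
  have h2 := ((Real.smoothTransition.contDiff (n := 1)).differentiable (by simp)
    ((k + 1) * (s - t))).hasDerivAt
  rw [mul_comm]
  exact (h2.comp s h1).deriv

theorem deriv_smoothStep_nonneg (k : ℕ) (t s : ℝ) : 0 ≤ _root_.deriv (smoothStep k t) s := by
  rw [deriv_smoothStep]
  exact mul_nonneg (by positivity) Real.smoothTransition.monotone.deriv_nonneg

theorem tendsto_smoothStep (t s : ℝ) :
    Tendsto (fun k => smoothStep k t s) atTop (𝓝 ((Ioi t).indicator 1 s)) := by
  by_cases h : t < s
  · rw [indicator_of_mem (show s ∈ Ioi t from h)]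
    refine tendsto_const_nhds.congr' ?_
    obtain ⟨N, hN⟩ := exists_nat_gt (s - t)⁻¹
    filter_upwards [eventually_ge_atTop N] with k hk
    have hst : 0 < s - t := sub_pos.2 h
    have : (1 : ℝ) ≤ (k + 1) * (s - t) := by
      rw [← inv_le_iff_one_le_mul₀ hst]
      have : (N : ℝ) ≤ k := by exact_mod_cast hk
      linarith
    rw [smoothStep, Real.smoothTransition.one_of_one_le this]; rfl
  · rw [indicator_of_notMem (show s ∉ Ioi t from h)]
    refine tendsto_const_nhds.congr fun k => ?_
    rw [smoothStep, Real.smoothTransition.zero_of_nonpos]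
    exact mul_nonpos_of_nonneg_of_nonpos (by positivity) (by linarith)

/-- The perimeter of a superlevel set is bounded by the mean gradient in thin layers. -/
theorem horizontalPerimeter_superlevel_le {f : M → ℝ} (hf : ContMDiff (𝓡 n) 𝓘(ℝ, ℝ) ∞ f)
    (Ω : Set M) (t : ℝ) :
    C.horizontalPerimeter {x | t < f x} Ω ≤ liminf (fun k : ℕ =>
      ∫⁻ x, ENNReal.ofReal (_root_.deriv (smoothStep k t) (f x)) *
        ENNReal.ofReal (C.gradNorm f x) ∂C.vol) atTop := by
  refine iSup₂_le fun φ hφ => ?_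
  let Y : M → ℝ := fun x => ∑ j, C.formalAdjoint j (φ j) x
  have hYc : Continuous Y :=
    continuous_finsetSum _ fun j _ => C.continuous_formalAdjoint j (hφ.1 j).1
  have hYi : Integrable Y C.vol := integrable_finsetSum _ fun j _ =>
    C.integrable_of_hasCompactSupport (C.continuous_formalAdjoint j (hφ.1 j).1)
      (C.hasCompactSupport_formalAdjoint j (hφ.1 j).2.1)
  have hYΩ : ∀ x, x ∉ Ω → Y x = 0 := fun x hx => Finset.sum_eq_zero fun j _ =>
    C.formalAdjoint_eq_zero j fun h => hx ((hφ.1 j).2.2 h)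
  have hΩ : ∫ x in Ω, ({x | t < f x}.indicator 1 x : ℝ) * Y x ∂C.vol =
      ∫ x, ({x | t < f x}.indicator 1 x : ℝ) * Y x ∂C.vol :=
    setIntegral_eq_integral_of_forall_compl_eq_zero fun x hx => by rw [hYΩ x hx, mul_zero]
  -- For a fixed test field the indicator of `{t < f}` is replaced by smooth steps of `f`; dominated
  -- convergence recovers the indicator, strictly at level `t` because each step vanishes up to `t`.
  have hlim : Tendsto (fun k => ∫ x, smoothStep k t (f x) * Y x ∂C.vol) atTop
      (𝓝 (∫ x, ({x | t < f x}.indicator 1 x : ℝ) * Y x ∂C.vol)) := by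
    refine tendsto_integral_of_dominated_convergence (fun x => |Y x|) (fun k => ?_) hYi.abs
      (fun k => Eventually.of_forall fun x => ?_) (Eventually.of_forall fun x => ?_)
    · exact (((contDiff_smoothStep k t).continuous.comp hf.continuous).mul
        hYc).measurable.aestronglyMeasurable
    · rw [Real.norm_eq_abs, abs_mul, smoothStep, abs_of_nonneg (Real.smoothTransition.nonneg _)]
      exact mul_le_of_le_one_left (abs_nonneg _) (Real.smoothTransition.le_one _)
    · exact (tendsto_smoothStep t (f x)).mul_const _
  change ENNReal.ofReal (∫ x in Ω, ({x | t < f x}.indicator 1 x : ℝ) * Y x ∂C.vol) ≤ _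
  rw [hΩ, ← ((ENNReal.continuous_ofReal.tendsto _).comp hlim).liminf_eq]
  refine liminf_le_liminf (Eventually.of_forall fun k => ?_)
  have hη := contDiff_smoothStep k t
  have hg : ContMDiff (𝓡 n) 𝓘(ℝ, ℝ) ∞ (smoothStep k t ∘ f) := hη.contMDiff.comp hf
  have hibp : ∫ x, smoothStep k t (f x) * Y x ∂C.vol =
      ∫ x, ∑ j, C.deriv j (smoothStep k t ∘ f) x * φ j x ∂C.vol := by
    have h1 : ∀ x, smoothStep k t (f x) * Y x =
        ∑ j, (smoothStep k t ∘ f) x * C.formalAdjoint j (φ j) x := fun x => by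
      rw [← Finset.mul_sum]; rfl
    simp_rw [h1]
    rw [integral_finsetSum, integral_finsetSum]
    · exact Finset.sum_congr rfl fun j _ =>
        C.integral_mul_formalAdjoint j hg (hφ.1 j).1 (hφ.1 j).2.1
    · exact fun j _ => C.integrable_of_hasCompactSupport
        ((C.continuous_deriv j hg).mul (hφ.1 j).1.continuous) (hφ.1 j).2.1.mul_left
    · exact fun j _ => C.integrable_of_hasCompactSupport
        (hg.continuous.mul (C.continuous_formalAdjoint j (hφ.1 j).1))
        (C.hasCompactSupport_formalAdjoint j (hφ.1 j).2.1).mul_left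
  rw [Function.comp_apply, hibp]
  refine (Real.ofReal_le_enorm _).trans ((enorm_integral_le_lintegral_enorm _).trans
    (lintegral_mono fun x => ?_))
  rw [← ENNReal.ofReal_mul (deriv_smoothStep_nonneg k t _), ← ofReal_norm,
    Real.norm_eq_abs]
  refine ENNReal.ofReal_le_ofReal ?_
  have hd : ∀ j, C.deriv j (smoothStep k t ∘ f) x =
      _root_.deriv (smoothStep k t) (f x) * C.deriv j f x := fun j =>
    along_comp (V := C.X j) (hη.differentiable (by simp) _) ((hf x).mdifferentiableAt (by simp))
  simp_rw [hd, mul_assoc]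
  rw [← Finset.mul_sum, abs_mul, abs_of_nonneg (deriv_smoothStep_nonneg k t _)]
  refine mul_le_mul_of_nonneg_left ?_ (deriv_smoothStep_nonneg k t _)
  -- Cauchy–Schwarz in `ℝᵐ` together with `|φ| ≤ 1` removes the test field, so the bound is uniform
  -- in `φ`.
  have hcs := Finset.sum_mul_sq_le_sq_mul_sq Finset.univ (fun j => C.deriv j f x)
    (fun j => φ j x)
  rw [gradNorm]
  refine Real.abs_le_sqrt (hcs.trans ?_)
  refine mul_le_of_le_one_right (Finset.sum_nonneg fun j _ => sq_nonneg _) ?_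
  exact (Real.sqrt_le_one).1 (hφ.2 x)

end CCSpace

end

end CC

/-! ### Regular levels, the coarea inequality and the Poincaré inequality for test functions. -/

namespace CC

section

variable {n m : ℕ} {M : Type*} [TopologicalSpace M] [ChartedSpace (Model n) M]
  [IsManifold (𝓡 n) ∞ M]

theorem fderiv_comp_chart_symm {f : M → ℝ} {p q : M}
    (hq : q ∈ (extChartAt (𝓡 n) p).source) (hf : MDifferentiableAt (𝓡 n) 𝓘(ℝ, ℝ) f q) :
    fderiv ℝ (f ∘ (extChartAt (𝓡 n) p).symm) (extChartAt (𝓡 n) p q) =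
      (mfderiv (𝓡 n) 𝓘(ℝ, ℝ) f q : Model n →L[ℝ] ℝ) ∘L
        chartFrame p (extChartAt (𝓡 n) p q) := by
  have hy := (extChartAt (𝓡 n) p).map_source hq
  have hsy : (extChartAt (𝓡 n) p).symm (extChartAt (𝓡 n) p q) = q :=
    (extChartAt (𝓡 n) p).left_inv hq
  have h2 : HasMFDerivAt (𝓡 n) 𝓘(ℝ, ℝ) f
      ((extChartAt (𝓡 n) p).symm (extChartAt (𝓡 n) p q))
      (mfderiv (𝓡 n) 𝓘(ℝ, ℝ) f q : Model n →L[ℝ] ℝ) := by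
    have h1 : ∀ x, x = q → HasMFDerivAt (𝓡 n) 𝓘(ℝ, ℝ) f x
        (mfderiv (𝓡 n) 𝓘(ℝ, ℝ) f q : Model n →L[ℝ] ℝ) := by
      rintro _ rfl
      exact hf.hasMFDerivAt
    exact h1 _ hsy
  have h3 := (h2.comp _ (mdifferentiableAt_chart_symm hy).hasMFDerivAt).mfderiv
  rw [mfderiv_eq_fderiv] at h3
  exact h3

theorem fderiv_comp_chart_symm_eq_zero_iff {f : M → ℝ} {p q : M}
    (hq : q ∈ (extChartAt (𝓡 n) p).source) (hf : MDifferentiableAt (𝓡 n) 𝓘(ℝ, ℝ) f q) :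
    fderiv ℝ (f ∘ (extChartAt (𝓡 n) p).symm) (extChartAt (𝓡 n) p q) = 0 ↔
      mfderiv (𝓡 n) 𝓘(ℝ, ℝ) f q = 0 := by
  rw [fderiv_comp_chart_symm hq hf]
  obtain ⟨A, hA⟩ := isInvertible_chartFrame ((extChartAt (𝓡 n) p).map_source hq)
  rw [← hA]
  constructor
  · intro h
    refine ContinuousLinearMap.ext fun v : Model n => ?_
    have := DFunLike.congr_fun h (A.symm v)
    change (mfderiv (𝓡 n) 𝓘(ℝ, ℝ) f q : Model n →L[ℝ] ℝ) (A (A.symm v)) = 0 at this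
    rwa [A.apply_symm_apply] at this
  · intro h
    rw [h]
    exact ContinuousLinearMap.zero_comp _

theorem ae_regular_value [SigmaCompactSpace M] {f : M → ℝ}
    (hf : ContMDiff (𝓡 n) 𝓘(ℝ, ℝ) ∞ f) :
    ∀ᵐ t : ℝ, ∀ x, f x = t → mfderiv (𝓡 n) 𝓘(ℝ, ℝ) f x ≠ 0 := by
  have : SecondCountableTopology M := ChartedSpace.secondCountable_of_sigmaCompact (Model n) M
  have hnull : volume (f '' {x | mfderiv (𝓡 n) 𝓘(ℝ, ℝ) f x = 0}) = 0 := by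
    refine volume_image_null_of_locally fun p _ =>
      ⟨_, extChartAt_source_mem_nhds (I := 𝓡 n) p, ?_⟩
    refine measure_mono_null ?_ (volume_image_critical_eq_zero _ (Model n) rfl
      (f ∘ (extChartAt (𝓡 n) p).symm) _ (isOpen_extChartAt_target p)
      fun y hy => CCSpace.contDiffAt_comp_chart_symm hy (hf _))
    rintro _ ⟨q, ⟨hq, hq0⟩, rfl⟩
    refine ⟨extChartAt (𝓡 n) p q, ⟨(extChartAt (𝓡 n) p).map_source hq, ?_⟩, ?_⟩
    · exact (fderiv_comp_chart_symm_eq_zero_iff hq ((hf q).mdifferentiableAt (by simp))).2 hq0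
    · rw [Function.comp_apply, (extChartAt (𝓡 n) p).left_inv hq]
  filter_upwards [measure_eq_zero_iff_ae_notMem.1 hnull] with t ht x hx h0
  exact ht ⟨x, h0, hx⟩

theorem hasPiecewiseSmoothBoundary_superlevel {f : M → ℝ}
    (hf : ContMDiff (𝓡 n) 𝓘(ℝ, ℝ) ∞ f) {t : ℝ}
    (ht : ∀ x, f x = t → mfderiv (𝓡 n) 𝓘(ℝ, ℝ) f x ≠ 0) :
    HasPiecewiseSmoothBoundary n {x | t < f x} := by
  intro p hp
  have hpt : t = f p := frontier_lt_subset_eq continuous_const hf.continuous hp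
  have hfd : ∀ q, MDifferentiableAt (𝓡 n) 𝓘(ℝ, ℝ) f q := fun q =>
    (hf q).mdifferentiableAt (by simp)
  have hne : ∀ᶠ q in 𝓝 p, mfderiv (𝓡 n) 𝓘(ℝ, ℝ) f q ≠ 0 := by
    have h1 := ((CCSpace.contDiffAt_comp_chart_symm (mem_extChartAt_target (I := 𝓡 n) p)
      (hf _)).fderiv_right (m := 0) (by simp)).continuousAt
    have h2 : fderiv ℝ (f ∘ (extChartAt (𝓡 n) p).symm) (extChartAt (𝓡 n) p p) ≠ 0 := fun h =>
      ht p hpt.symm ((fderiv_comp_chart_symm_eq_zero_iff (mem_extChartAt_source p) (hfd p)).1 h)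
    filter_upwards [(h1.comp (continuousAt_extChartAt p)).eventually_ne h2,
      extChartAt_source_mem_nhds (I := 𝓡 n) p] with q hq hqs h0
    exact hq ((fderiv_comp_chart_symm_eq_zero_iff hqs (hfd q)).2 h0)
  obtain ⟨U, hU, hUo, hpU⟩ := mem_nhds_iff.1 hne
  -- Near a regular boundary point the superlevel set is the single half-space `{t - f < 0}`.
  refine ⟨U, hUo, hpU, 1, fun _ q => t - f q, {univ}, fun _ => ?_, fun _ q hq => ?_, fun q _ => ?_⟩
  · exact (contMDiff_const.sub hf).contMDiffOn
  · have h1 := ((hasMFDerivAt_const (I := 𝓡 n) (I' := 𝓘(ℝ, ℝ)) t q).sub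
      (hfd q).hasMFDerivAt).mfderiv
    intro h0
    refine hU hq (ContinuousLinearMap.ext fun v : Model n => ?_)
    let d : Model n →L[ℝ] ℝ := mfderiv (𝓡 n) 𝓘(ℝ, ℝ) f q
    have h2 : (0 : ℝ) = 0 - d v := (DFunLike.congr_fun h0 v).symm.trans (DFunLike.congr_fun h1 v)
    have h3 : d v = 0 := by linarith
    exact h3
  · simp

variable [MeasurableSpace M] [BorelSpace M] [SigmaCompactSpace M] [T2Space M]

namespace CCSpace

variable (C : CCSpace n m M)

/-- The step depends only on `a - t`, so its derivative in `a` is minus its derivative in `t`. As a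
function of `t` it is antitone with values in `[0, 1]`, hence the integral is the length of a subset
of `[0, 1]`. -/
theorem lintegral_deriv_smoothStep_le (k : ℕ) (a : ℝ) :
    ∫⁻ t, ENNReal.ofReal (_root_.deriv (smoothStep k t) a) ≤ 1 := by
  have hd : ∀ t, HasDerivAt (fun t => smoothStep k t a)
      (-_root_.deriv (smoothStep k t) a) t := fun t => by
    have h1 : HasDerivAt (fun t : ℝ => (k + 1 : ℝ) * (a - t)) (-(k + 1)) t := by
      simpa using ((hasDerivAt_id t).const_sub a).const_mul (k + 1 : ℝ)
    have h2 := ((Real.smoothTransition.contDiff (n := 1)).differentiable (by simp)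
      ((k + 1) * (a - t))).hasDerivAt
    have h3 := h2.comp t h1
    rw [deriv_smoothStep]
    convert! h3 using 1
    ring
  have hanti : AntitoneOn (fun t => smoothStep k t a) univ := fun s _ t _ hst => by
    refine Real.smoothTransition.monotone ?_
    exact mul_le_mul_of_nonneg_left (by linarith) (by positivity)
  have h := lintegral_deriv_eq_volume_image_of_antitoneOn MeasurableSet.univ
    (fun t _ => (hd t).hasDerivWithinAt) hanti
  simp only [neg_neg, Measure.restrict_univ] at h
  rw [h]
  have hsub : (fun t => smoothStep k t a) '' univ ⊆ Icc 0 1 := by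
    rintro _ ⟨t, -, rfl⟩
    exact ⟨Real.smoothTransition.nonneg _, Real.smoothTransition.le_one _⟩
  refine (measure_mono hsub).trans ?_
  simp

/-- The coarea inequality for superlevel sets. -/
theorem mul_lintegral_superlevel_le {f : M → ℝ} (hf : ContMDiff (𝓡 n) 𝓘(ℝ, ℝ) ∞ f)
    {Ω : Set M} {h : ℝ≥0∞}
    (hper : ∀ᵐ t : ℝ, 0 < t → h * C.vol {x | t < f x} ≤ C.horizontalPerimeter {x | t < f x} Ω) :
    h * ∫⁻ t in Ioi 0, C.vol {x | t < f x} ≤ ∫⁻ x, ENNReal.ofReal (C.gradNorm f x) ∂C.vol := by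
  have := C.isLocallyFiniteMeasure_vol
  have : SecondCountableTopology M := ChartedSpace.secondCountable_of_sigmaCompact (Model n) M
  let G : ℕ → ℝ → M → ℝ≥0∞ := fun k t x =>
    ENNReal.ofReal (_root_.deriv (smoothStep k t) (f x)) * ENNReal.ofReal (C.gradNorm f x)
  have hθ : Continuous (_root_.deriv Real.smoothTransition) :=
    (Real.smoothTransition.contDiff (n := 1)).continuous_deriv (by simp)
  have hGm : ∀ k, Measurable (Function.uncurry (G k)) := fun k => by
    have h1 : Continuous fun z : ℝ × M =>
        (k + 1 : ℝ) * _root_.deriv Real.smoothTransition ((k + 1) * (f z.2 - z.1)) :=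
      continuous_const.mul (hθ.comp (continuous_const.mul
        ((hf.continuous.comp continuous_snd).sub continuous_fst)))
    have h2 : Continuous fun z : ℝ × M => C.gradNorm f z.2 :=
      (C.continuous_gradNorm hf).comp continuous_snd
    have h3 : Function.uncurry (G k) = fun z : ℝ × M => ENNReal.ofReal
        ((k + 1 : ℝ) * _root_.deriv Real.smoothTransition ((k + 1) * (f z.2 - z.1))) *
          ENNReal.ofReal (C.gradNorm f z.2) := by
      ext z
      simp only [Function.uncurry, G, deriv_smoothStep]
    rw [h3]
    exact h1.measurable.ennreal_ofReal.mul h2.measurable.ennreal_ofReal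
  -- The perimeter bound at almost every level is followed by Fatou's lemma in `t` and Tonelli's
  -- theorem; the inner integral over `t` is then at most `1`.
  calc h * ∫⁻ t in Ioi 0, C.vol {x | t < f x}
      ≤ ∫⁻ t in Ioi 0, h * C.vol {x | t < f x} := lintegral_const_mul_le _ _
    _ ≤ ∫⁻ t in Ioi 0, liminf (fun k => ∫⁻ x, G k t x ∂C.vol) atTop := by
        refine setLIntegral_mono_ae' measurableSet_Ioi ?_
        filter_upwards [hper] with t ht ht0
        exact (ht ht0).trans (C.horizontalPerimeter_superlevel_le hf Ω t)
    _ ≤ ∫⁻ t, liminf (fun k => ∫⁻ x, G k t x ∂C.vol) atTop := setLIntegral_le_lintegral _ _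
    _ ≤ liminf (fun k => ∫⁻ t, ∫⁻ x, G k t x ∂C.vol) atTop :=
        lintegral_liminf_le fun k => (hGm k).lintegral_prod_right'
    _ ≤ liminf (fun _ : ℕ => ∫⁻ x, ENNReal.ofReal (C.gradNorm f x) ∂C.vol) atTop := by
        refine liminf_le_liminf (Eventually.of_forall fun k => ?_)
        rw [lintegral_lintegral_swap (hGm k).aemeasurable]
        refine lintegral_mono fun x => ?_
        simp only [G]
        rw [lintegral_mul_const' _ _ ENNReal.ofReal_ne_top]
        exact mul_le_of_le_one_left zero_le (lintegral_deriv_smoothStep_le k (f x))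
    _ = _ := liminf_const _

/-- The layer-cake formula turns the left side into an integral over levels. By Sard almost every
nonempty superlevel set is admissible in the infimum; positivity of `t` keeps its closure inside the
support of `f`. -/
theorem cheegerD_mul_lintegral_le {Ω : Set M} {f : M → ℝ} (hf : IsTestFunction n Ω f)
    (hf0 : ∀ x, 0 ≤ f x) :
    C.cheegerD Ω * ∫⁻ x, ENNReal.ofReal (f x) ∂C.vol ≤
      ∫⁻ x, ENNReal.ofReal (C.gradNorm f x) ∂C.vol := by
  rw [lintegral_eq_lintegral_meas_lt C.vol (Eventually.of_forall hf0)
    hf.1.continuous.measurable.aemeasurable]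
  refine C.mul_lintegral_superlevel_le (Ω := Ω) hf.1 ?_
  filter_upwards [ae_regular_value hf.1] with t ht ht0
  rcases eq_empty_or_nonempty {x | t < f x} with he | hne
  · simp [he]
  refine ENNReal.mul_le_of_le_div (iInf₂_le {x | t < f x} ⟨?_, hne, ?_, ?_, ?_⟩)
  · exact isOpen_lt continuous_const hf.1.continuous
  all_goals try
    have hsub : closure {x | t < f x} ⊆ tsupport f :=
      closure_mono fun x hx => (ht0.trans hx).ne'
  · exact hf.2.1.isCompact.of_isClosed_subset isClosed_closure hsub
  · exact hsub.trans hf.2.2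
  · exact hasPiecewiseSmoothBoundary_superlevel hf.1 ht

/-- The `L¹` inequality is applied to `φ²`: with `a = ∫ φ²` and `b = ∫ |∇_H φ|²` it reads `h a ≤ 2
√a √b`, that is `h² / 4 ≤ b / a`. A real `c` stands in for `h² / 4`, which may be infinite. -/
theorem poincare {Ω : Set M} {φ : M → ℝ} (hφ : IsTestFunction n Ω φ) {c : ℝ}
    (hch : ENNReal.ofReal c ≤ C.cheegerD Ω ^ 2 / 4) :
    c * ∫ x, φ x ^ 2 ∂C.vol ≤ ∑ j, ∫ x, C.deriv j φ x ^ 2 ∂C.vol := by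
  have hdi : ∀ j, Integrable (fun x => C.deriv j φ x ^ 2) C.vol := fun j =>
    C.integrable_of_hasCompactSupport ((C.continuous_deriv j hφ.1).pow 2)
      ((C.hasCompactSupport_deriv j hφ.2.1).comp_left (g := fun t : ℝ => t ^ 2) (by simp))
  have hφi : Integrable (fun x => φ x ^ 2) C.vol :=
    C.integrable_of_hasCompactSupport (hφ.1.continuous.pow 2)
      (hφ.2.1.comp_left (g := fun t : ℝ => t ^ 2) (by simp))
  rw [← integral_finsetSum _ fun j _ => hdi j]
  have hsq : ∀ x, ∑ j, C.deriv j φ x ^ 2 = C.gradNorm φ x ^ 2 := fun x =>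
    (Real.sq_sqrt (Finset.sum_nonneg fun j _ => sq_nonneg _)).symm
  simp_rw [hsq]
  have hgi : Integrable (fun x => C.gradNorm φ x ^ 2) C.vol := by
    simp_rw [← hsq]; exact integrable_finsetSum _ fun j _ => hdi j
  set a := ∫ x, φ x ^ 2 ∂C.vol
  set b := ∫ x, C.gradNorm φ x ^ 2 ∂C.vol
  have ha : 0 ≤ a := integral_nonneg fun x => sq_nonneg _
  have hb : 0 ≤ b := integral_nonneg fun x => sq_nonneg _
  have hf : IsTestFunction n Ω (fun x => φ x ^ 2) := by
    refine ⟨hφ.1.pow 2, hφ.2.1.comp_left (g := fun t : ℝ => t ^ 2) (by simp), ?_⟩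
    refine (closure_mono ?_).trans hφ.2.2
    intro x hx hx0
    exact hx (by simp [hx0])
  have h1 := C.cheegerD_mul_lintegral_le hf fun x => sq_nonneg _
  have hgrad : ∀ x, C.gradNorm (fun x => φ x ^ 2) x = 2 * (|φ x| * C.gradNorm φ x) := fun x => by
    have hd : ∀ j, C.deriv j (fun x => φ x ^ 2) x = 2 * φ x * C.deriv j φ x := fun j => by
      have h2 := along_mul (V := C.X j) ((hφ.1 x).mdifferentiableAt (by simp))
        ((hφ.1 x).mdifferentiableAt (by simp))
      have h3 : (fun x => φ x ^ 2) = φ * φ := by ext; simp [sq]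
      rw [h3]
      refine Eq.trans h2 ?_
      change φ x * C.deriv j φ x + φ x * C.deriv j φ x = _
      ring
    rw [gradNorm]
    simp_rw [hd, mul_pow]
    rw [← Finset.mul_sum, Real.sqrt_mul (by positivity), ← mul_pow, Real.sqrt_sq_eq_abs, abs_mul,
      abs_two, mul_assoc]
    rfl
  have hL2φ : MemLp (fun x => |φ x|) (ENNReal.ofReal 2) C.vol := by
    rw [ENNReal.ofReal_ofNat]
    refine (memLp_two_iff_integrable_sq hφ.1.continuous.abs.measurable.aestronglyMeasurable).2 ?_
    simpa using hφi
  have hL2g : MemLp (fun x => C.gradNorm φ x) (ENNReal.ofReal 2) C.vol := by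
    rw [ENNReal.ofReal_ofNat]
    exact (memLp_two_iff_integrable_sq
      (C.continuous_gradNorm hφ.1).measurable.aestronglyMeasurable).2 hgi
  have hhol := integral_mul_le_Lp_mul_Lq_of_nonneg Real.HolderConjugate.two_two
    (Eventually.of_forall fun x => abs_nonneg (φ x))
    (Eventually.of_forall fun x => Real.sqrt_nonneg (∑ j, C.deriv j φ x ^ 2)) hL2φ hL2g
  have hhol2 : ∫ x, |φ x| * C.gradNorm φ x ∂C.vol ≤ √a * √b := by
    simpa [Real.sqrt_eq_rpow, a, b, gradNorm] using hhol
  have hint : Integrable (fun x => 2 * (|φ x| * C.gradNorm φ x)) C.vol :=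
    C.integrable_of_hasCompactSupport
      (continuous_const.mul (hφ.1.continuous.abs.mul (C.continuous_gradNorm hφ.1)))
      ((hφ.2.1.comp_left (g := fun t : ℝ => |t|) (by simp)).mul_right.mul_left)
  simp_rw [hgrad] at h1
  rw [← ofReal_integral_eq_lintegral_ofReal hφi (Eventually.of_forall fun x => sq_nonneg _),
    ← ofReal_integral_eq_lintegral_ofReal hint (Eventually.of_forall fun x =>
      mul_nonneg zero_le_two (mul_nonneg (abs_nonneg _) (Real.sqrt_nonneg _))),
    integral_const_mul] at h1
  have h2 : C.cheegerD Ω * ENNReal.ofReal a ≤ ENNReal.ofReal (2 * (√a * √b)) :=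
    h1.trans (ENNReal.ofReal_le_ofReal (by linarith))
  -- The case `a = 0` is separate because the quotient `b / a` is formed next.
  rcases ha.eq_or_lt with ha0 | ha0
  · rw [← ha0, mul_zero]; exact hb
  have h3 : C.cheegerD Ω ≤ ENNReal.ofReal (2 * (√a * √b) / a) := by
    rw [ENNReal.ofReal_div_of_pos ha0]
    exact (ENNReal.le_div_iff_mul_le (Or.inl (by simpa using ha0)) (Or.inl (by simp))).2 h2
  have h4 : ENNReal.ofReal c ≤ ENNReal.ofReal ((2 * (√a * √b) / a) ^ 2 / 4) := by
    rw [ENNReal.ofReal_div_of_pos (by norm_num), ENNReal.ofReal_pow (by positivity),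
      ENNReal.ofReal_ofNat]
    exact hch.trans (ENNReal.div_le_div_right (pow_le_pow_left' h3 2) _)
  have h5 := (ENNReal.ofReal_le_ofReal_iff (by positivity)).1 h4
  have h6 : (2 * (√a * √b) / a) ^ 2 / 4 = b / a := by
    rw [div_pow, mul_pow, mul_pow, Real.sq_sqrt ha, Real.sq_sqrt hb]
    field_simp
    ring
  rw [h6] at h5
  exact (le_div_iff₀ ha0).1 h5

end CCSpace

end

end CC

/-! ### The Sobolev spaces as closed subspaces, and the spectrum. -/

namespace CC

namespace CCSpace

variable {n m : ℕ} {M : Type*} [TopologicalSpace M] [ChartedSpace (Model n) M]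
  [IsManifold (𝓡 n) ∞ M] [MeasurableSpace M] [BorelSpace M] [SigmaCompactSpace M] [T2Space M]
  (C : CCSpace n m M)

theorem memLp_two_of_hasCompactSupport {g : M → ℝ} (hg : Continuous g) (hc : HasCompactSupport g)
    (Ω : Set M) : MemLp g 2 (C.vol.restrict Ω) := by
  have := C.isLocallyFiniteMeasure_vol
  exact (hg.memLp_of_hasCompactSupport hc).restrict Ω

/-- The class in `L²(Ω)` of a continuous function with compact support. -/
noncomputable def toL2 (Ω : Set M) {g : M → ℝ} (hg : Continuous g) (hc : HasCompactSupport g) :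
    C.L2 Ω :=
  (C.memLp_two_of_hasCompactSupport hg hc Ω).toLp g

theorem inner_toL2 {Ω : Set M} {g : M → ℝ} (hg : Continuous g) (hc : HasCompactSupport g)
    (u : C.L2 Ω) : inner ℝ (C.toL2 Ω hg hc) u = ∫ x in Ω, u x * g x ∂C.vol := by
  rw [MeasureTheory.L2.inner_def]
  refine integral_congr_ae ?_
  filter_upwards [(C.memLp_two_of_hasCompactSupport hg hc Ω).coeFn_toLp] with x hx
  rw [toL2, hx]
  simp

theorem norm_sq_toL2 {Ω : Set M} {g : M → ℝ} (hg : Continuous g) (hc : HasCompactSupport g)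
    (hΩ : ∀ x, x ∉ Ω → g x = 0) : ‖C.toL2 Ω hg hc‖ ^ 2 = ∫ x, g x ^ 2 ∂C.vol := by
  rw [← real_inner_self_eq_norm_sq, C.inner_toL2,
    ← setIntegral_eq_integral_of_forall_compl_eq_zero (μ := C.vol) (s := Ω) (f := fun x => g x ^ 2)
      (fun x hx => by rw [hΩ x hx]; simp)]
  refine integral_congr_ae ?_
  filter_upwards [(C.memLp_two_of_hasCompactSupport hg hc Ω).coeFn_toLp] with x hx
  rw [toL2, hx, sq]

theorem edist_toL2 {Ω : Set M} {g : M → ℝ} (hg : Continuous g) (hc : HasCompactSupport g)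
    (u : C.L2 Ω) :
    edist u (C.toL2 Ω hg hc) = eLpNorm (fun x => u x - g x) 2 (C.vol.restrict Ω) := by
  rw [Lp.edist_def]
  refine eLpNorm_congr_ae ?_
  filter_upwards [(C.memLp_two_of_hasCompactSupport hg hc Ω).coeFn_toLp] with x hx
  rw [Pi.sub_apply, toL2, hx]

theorem toL2_congr {Ω : Set M} {g g' : M → ℝ} (hg : Continuous g) (hc : HasCompactSupport g)
    (h : g = g') : C.toL2 Ω hg hc = C.toL2 Ω (h ▸ hg) (h ▸ hc) := by
  subst h; rfl

theorem toL2_add {Ω : Set M} {g g' : M → ℝ} (hg : Continuous g) (hc : HasCompactSupport g)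
    (hg' : Continuous g') (hc' : HasCompactSupport g') (h : Continuous (g + g'))
    (h' : HasCompactSupport (g + g')) :
    C.toL2 Ω h h' = C.toL2 Ω hg hc + C.toL2 Ω hg' hc' :=
  MemLp.toLp_add (C.memLp_two_of_hasCompactSupport hg hc Ω)
    (C.memLp_two_of_hasCompactSupport hg' hc' Ω)

theorem toL2_const_smul {Ω : Set M} {g : M → ℝ} (hg : Continuous g) (hc : HasCompactSupport g)
    (c : ℝ) (h : Continuous (c • g)) (h' : HasCompactSupport (c • g)) :
    C.toL2 Ω h h' = c • C.toL2 Ω hg hc :=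
  MemLp.toLp_const_smul c (C.memLp_two_of_hasCompactSupport hg hc Ω)

/-- A test function together with its horizontal derivatives. -/
noncomputable def testPair {Ω : Set M} {φ : M → ℝ} (hφ : IsTestFunction n Ω φ) :
    C.L2 Ω × (Fin m → C.L2 Ω) :=
  (C.toL2 Ω hφ.1.continuous hφ.2.1,
    fun j => C.toL2 Ω (C.continuous_deriv j hφ.1) (C.hasCompactSupport_deriv j hφ.2.1))

/-- Each distributional identity equates two continuous linear functionals of the pair; linearity
and closedness of the space follow. -/
theorem mem_sobolev_iff {Ω : Set M} {U : C.L2 Ω × (Fin m → C.L2 Ω)} :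
    U ∈ C.sobolev Ω ↔ ∀ (j : Fin m) (φ : M → ℝ) (hφ : IsTestFunction n Ω φ),
      inner ℝ (C.toL2 Ω (C.continuous_formalAdjoint j hφ.1)
        (C.hasCompactSupport_formalAdjoint j hφ.2.1)) U.1 =
      inner ℝ (C.toL2 Ω hφ.1.continuous hφ.2.1) (U.2 j) := by
  simp_rw [inner_toL2]
  rfl

/-- The Sobolev space `S¹(Ω)` as a subspace. -/
noncomputable def sobolevSubmodule (Ω : Set M) : Submodule ℝ (C.L2 Ω × (Fin m → C.L2 Ω)) where
  carrier := C.sobolev Ω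
  add_mem' {U V} hU hV := by
    rw [mem_sobolev_iff] at *
    intro j φ hφ
    simp [inner_add_right, hU j φ hφ, hV j φ hφ]
  zero_mem' := by
    rw [mem_sobolev_iff]
    intro j φ hφ
    simp
  smul_mem' c U hU := by
    rw [mem_sobolev_iff] at *
    intro j φ hφ
    simp [inner_smul_right, hU j φ hφ]

theorem isClosed_sobolev (Ω : Set M) : IsClosed (C.sobolev Ω) := by
  have : C.sobolev Ω = ⋂ (j : Fin m) (φ : M → ℝ) (hφ : IsTestFunction n Ω φ),
      {U | inner ℝ (C.toL2 Ω (C.continuous_formalAdjoint j hφ.1)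
        (C.hasCompactSupport_formalAdjoint j hφ.2.1)) U.1 =
      inner ℝ (C.toL2 Ω hφ.1.continuous hφ.2.1) (U.2 j)} := by
    ext U
    simp only [mem_iInter, mem_sobolev_iff, mem_ofPred_eq]
  rw [this]
  refine isClosed_iInter fun j => isClosed_iInter fun φ => isClosed_iInter fun hφ => ?_
  exact isClosed_eq (continuous_const.inner continuous_fst)
    (continuous_const.inner ((continuous_apply j).comp continuous_snd))

theorem isTestFunction_add {Ω : Set M} {φ ψ : M → ℝ} (hφ : IsTestFunction n Ω φ)
    (hψ : IsTestFunction n Ω ψ) : IsTestFunction n Ω (φ + ψ) :=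
  ⟨hφ.1.add hψ.1, hφ.2.1.add hψ.2.1, (tsupport_add φ ψ).trans (union_subset hφ.2.2 hψ.2.2)⟩

theorem isTestFunction_const_smul {Ω : Set M} {φ : M → ℝ} (hφ : IsTestFunction n Ω φ) (c : ℝ) :
    IsTestFunction n Ω (c • φ) :=
  ⟨contMDiff_const.mul hφ.1, hφ.2.1.mul_left (f := fun _ => c),
    (tsupport_mul_subset_right (f := fun _ => c) (g := φ)).trans hφ.2.2⟩

/-- The space of test functions, embedded in `S¹(Ω)`. -/
noncomputable def testSubmodule (Ω : Set M) : Submodule ℝ (C.L2 Ω × (Fin m → C.L2 Ω)) where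
  carrier := {U | ∃ (φ : M → ℝ) (hφ : IsTestFunction n Ω φ), C.testPair hφ = U}
  add_mem' := by
    rintro _ _ ⟨φ, hφ, rfl⟩ ⟨ψ, hψ, rfl⟩
    refine ⟨φ + ψ, isTestFunction_add hφ hψ, ?_⟩
    refine Prod.ext (C.toL2_add hφ.1.continuous hφ.2.1 hψ.1.continuous hψ.2.1
      (hφ.1.continuous.add hψ.1.continuous) (hφ.2.1.add hψ.2.1)) (funext fun j => ?_)
    have h : C.deriv j (φ + ψ) = C.deriv j φ + C.deriv j ψ := funext fun x =>
      along_add (V := C.X j) ((hφ.1 x).mdifferentiableAt (by simp))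
        ((hψ.1 x).mdifferentiableAt (by simp))
    have hφc := C.continuous_deriv j hφ.1
    have hφs := C.hasCompactSupport_deriv j hφ.2.1
    have hψc := C.continuous_deriv j hψ.1
    have hψs := C.hasCompactSupport_deriv j hψ.2.1
    exact (C.toL2_congr (C.continuous_deriv j (hφ.1.add hψ.1))
      (C.hasCompactSupport_deriv j (hφ.2.1.add hψ.2.1)) h).trans
      (C.toL2_add hφc hφs hψc hψs (hφc.add hψc) (hφs.add hψs))
  zero_mem' := by
    have h0 : IsTestFunction n Ω (0 : M → ℝ) :=
      ⟨contMDiff_const, HasCompactSupport.zero, by simp [tsupport]⟩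
    refine ⟨0, h0, ?_⟩
    refine Prod.ext (MemLp.toLp_zero (C.memLp_two_of_hasCompactSupport h0.1.continuous h0.2.1 Ω)) (funext fun j => ?_)
    have h : C.deriv j (0 : M → ℝ) = 0 := funext fun x => C.deriv_eq_zero j (by simp [tsupport])
    exact (C.toL2_congr (C.continuous_deriv j h0.1) (C.hasCompactSupport_deriv j h0.2.1) h).trans
      (MemLp.toLp_zero
      (C.memLp_two_of_hasCompactSupport h0.1.continuous h0.2.1 Ω))
  smul_mem' := by
    rintro c _ ⟨φ, hφ, rfl⟩
    have h1 := isTestFunction_const_smul hφ c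
    refine ⟨c • φ, h1, ?_⟩
    refine Prod.ext (C.toL2_const_smul hφ.1.continuous hφ.2.1 c h1.1.continuous h1.2.1) (funext fun j => ?_)
    have h : C.deriv j (c • φ) = c • C.deriv j φ := funext fun x =>
      along_comp (V := C.X j) (η := fun s => c * s) (differentiableAt_id.const_mul c)
        ((hφ.1 x).mdifferentiableAt (by simp)) |>.trans (by
          rw [deriv_const_mul_field, deriv_id'', mul_one]; rfl)
    have hφc := C.continuous_deriv j hφ.1
    have hφs := C.hasCompactSupport_deriv j hφ.2.1
    exact (C.toL2_congr (C.continuous_deriv j h1.1) (C.hasCompactSupport_deriv j h1.2.1) h).trans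
      (C.toL2_const_smul hφc hφs c (hφc.const_smul c) (h ▸ C.hasCompactSupport_deriv j h1.2.1))

/-- Componentwise `ε`-approximation is approximation in the sup metric of the product, so the second
condition describes a topological closure. -/
theorem mem_sobolevZero_iff {Ω : Set M} {U : C.L2 Ω × (Fin m → C.L2 Ω)} :
    U ∈ C.sobolevZero Ω ↔ U ∈ C.sobolevSubmodule Ω ⊓ (C.testSubmodule Ω).topologicalClosure := by
  refine and_congr Iff.rfl ?_
  have hcl : U ∈ (C.testSubmodule Ω).topologicalClosure ↔
      U ∈ closure (C.testSubmodule Ω : Set (C.L2 Ω × (Fin m → C.L2 Ω))) := Iff.rfl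
  have hed : ∀ (ε : ℝ≥0∞), 0 < ε → ∀ (φ : M → ℝ) (hφ : IsTestFunction n Ω φ),
      edist U (C.testPair hφ) < ε ↔
        eLpNorm (fun x => U.1 x - φ x) 2 (C.vol.restrict Ω) < ε ∧
        ∀ j, eLpNorm (fun x => U.2 j x - C.deriv j φ x) 2 (C.vol.restrict Ω) < ε := by
    intro ε hε φ hφ
    rw [Prod.edist_eq, max_lt_iff, edist_pi_def, Finset.sup_lt_iff hε]
    simp only [testPair, edist_toL2, Finset.mem_univ, true_imp_iff]
  refine Iff.trans ?_ hcl.symm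
  rw [EMetric.mem_closure_iff]
  refine forall₂_congr fun ε hε => ?_
  constructor
  · rintro ⟨φ, hφ, h⟩
    exact ⟨_, ⟨φ, hφ, rfl⟩, (hed ε hε φ hφ).2 h⟩
  · rintro ⟨_, ⟨φ, hφ, rfl⟩, h⟩
    exact ⟨φ, hφ, (hed ε hε φ hφ).1 h⟩

/-- Both sides are continuous in `U`, so the inequality extends from test functions to their
closure. -/
theorem poincare_of_mem_sobolevZero {Ω : Set M} {c : ℝ}
    (hch : ENNReal.ofReal c ≤ C.cheegerD Ω ^ 2 / 4) {U : C.L2 Ω × (Fin m → C.L2 Ω)}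
    (hU : U ∈ C.sobolevZero Ω) : c * ‖U.1‖ ^ 2 ≤ ∑ j, ‖U.2 j‖ ^ 2 := by
  have hclosed : IsClosed {U : C.L2 Ω × (Fin m → C.L2 Ω) |
      c * ‖U.1‖ ^ 2 ≤ ∑ j, ‖U.2 j‖ ^ 2} :=
    isClosed_le (continuous_const.mul (continuous_fst.norm.pow 2))
      (continuous_finsetSum _ fun j _ =>
        (((continuous_apply j).comp continuous_snd).norm.pow 2))
  refine closure_minimal ?_ hclosed (C.mem_sobolevZero_iff.1 hU).2
  rintro _ ⟨φ, hφ, rfl⟩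
  have hΩ : ∀ x, x ∉ Ω → x ∉ tsupport φ := fun x hx h => hx (hφ.2.2 h)
  have h1 := C.norm_sq_toL2 (Ω := Ω) hφ.1.continuous hφ.2.1
    fun x hx => image_eq_zero_of_notMem_tsupport (hΩ x hx)
  have h2 := fun j => C.norm_sq_toL2 (Ω := Ω) (C.continuous_deriv j hφ.1)
    (C.hasCompactSupport_deriv j hφ.2.1) fun x hx => C.deriv_eq_zero j (hΩ x hx)
  change c * ‖C.toL2 Ω hφ.1.continuous hφ.2.1‖ ^ 2 ≤ ∑ j, ‖C.toL2 Ω (C.continuous_deriv j hφ.1)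
    (C.hasCompactSupport_deriv j hφ.2.1)‖ ^ 2
  rw [h1, Finset.sum_congr rfl fun j _ => h2 j]
  exact C.poincare hφ hch

theorem notMem_dirichletSpectrum {Ω : Set M} {c l : ℝ} (hc : 0 ≤ c) (hl : l < c)
    (hch : ENNReal.ofReal c ≤ C.cheegerD Ω ^ 2 / 4) : l ∉ C.dirichletSpectrum Ω := by
  have hclosed : IsClosed ((C.sobolevSubmodule Ω ⊓ (C.testSubmodule Ω).topologicalClosure :
      Submodule ℝ (C.L2 Ω × (Fin m → C.L2 Ω))) : Set (C.L2 Ω × (Fin m → C.L2 Ω))) :=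
    (C.isClosed_sobolev Ω).inter (Submodule.isClosed_topologicalClosure _)
  obtain ⟨R, hR, hRu⟩ := exists_resolvent_of_lt _ hclosed hc hl
    fun U hU => C.poincare_of_mem_sobolevZero hch (C.mem_sobolevZero_iff.2 hU)
  refine fun h => h ⟨R, fun f => ?_, ?_⟩
  · obtain ⟨U, hU, hUR, hV⟩ := hR f
    exact ⟨U, C.mem_sobolevZero_iff.2 hU, hUR, fun V hVS => hV V (C.mem_sobolevZero_iff.1 hVS)⟩
  · rintro _ w ⟨U, hU, rfl, hV⟩
    exact hRu w U (C.mem_sobolevZero_iff.1 hU) fun V hVS => hV V (C.mem_sobolevZero_iff.2 hVS)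

end CCSpace

end CC

theorem mainTheorem3 {n m : ℕ} {M : Type*} [TopologicalSpace M] [ChartedSpace (CC.Model n) M]
    [IsManifold (𝓡 n) ∞ M] [T2Space M] [SigmaCompactSpace M] [ConnectedSpace M]
    [MeasurableSpace M] [BorelSpace M] (C : CC.CCSpace n m M)
    (Ω : Set M) (hΩ : IsOpen Ω) (hne : Ω.Nonempty) (hb : IsCompact (closure Ω)) :
    ((C.cheegerD Ω ^ 2 / 4 : ℝ≥0∞) : EReal) ≤ C.firstEigenvalueD Ω := by
  refine le_iInf₂ fun l hl => le_of_not_gt fun hlt => ?_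
  -- An infinite Cheeger constant admits every real `c`, in particular a nonnegative one above the
  -- given `l`; the spectrum then contains no real number.
  rcases eq_or_ne (C.cheegerD Ω ^ 2 / 4) ⊤ with htop | htop
  · exact C.notMem_dirichletSpectrum (c := max l 0 + 1) (by positivity)
      ((le_max_left l 0).trans_lt (lt_add_one _)) (by rw [htop]; exact le_top) hl
  · refine C.notMem_dirichletSpectrum (c := (C.cheegerD Ω ^ 2 / 4).toReal) ENNReal.toReal_nonneg
      ?_ (ENNReal.ofReal_toReal htop).le hl
    rw [← EReal.coe_ennreal_toReal htop] at hlt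
    exact EReal.coe_lt_coe_iff.1 hlt
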